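/- Conventions. Manifolds are smooth ($C^\infty$), Hausdorff and second countable. A spacetime $(M,g)$ is a connected, time-oriented Lorentzian manifold of dimension $n$, with $g$ of signature $(-,+,\dots,+)$. A tangent vector $v$ is timelike if $g(v,v)<0$, and causal if $v\neq 0$ and $g(v,v)\le 0$. Causal and timelike curves are piecewise smooth, and $J^\pm(A)$ denotes the causal future/past of $A\subset M$. A spacetime is globally hyperbolic if it is strongly causal and all the sets $J^+(p)\cap J^-(q)$ are compact. A subset $S\subset M$ is a Cauchy hypersurface if every inextendible timelike curve meets it exactly once. The gradient $\nabla f$ is defined by $g(\nabla f,\cdot)=df$. Let $(M,g)$ be a globally hyperbolic spacetime and let $t:M\to\mathbb R$ be a Cauchy time function: $t$ is continuous and onto, strictly increasing along every future-directed causal curve, and each level $S_c=t^{-1}(c)$, $c\in\mathbb R$, is a Cauchy hypersurface. For real numbers $c_-<a<c<b<c_+$, a smooth function $\tau:M\to\mathbb R$ is called a temporal step function around $c$, compatible with the outer extremes $c_-,c_+$ and the inner extremes $a,b$, if, with $V=\operatorname{Int}(\operatorname{Supp}(\nabla\tau))$: 1. $\nabla\tau$ is timelike and past-pointing at every point of $V$;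 2. $-1\le\tau\le 1$; 3. $\tau\equiv 1$ on $J^+(S_{c_+})$ and $\tau\equiv -1$ on $J^-(S_{c_-})$; 4. $S_{c'}\subset V$ for all $c'\in(a,b)$. **Proposition.** Assume that for every $c\in\mathbb R$ there are $a,b$ with $c-2<a<c<b<c+2$ and a temporal step function around $c$ compatible with the outer extremes $c-2,c+2$ and the inner extremes $a,b$. Then there exists a smooth function $\mathcal T:M\to\mathbb R$ such that: (A) $\nabla\mathcal T$ is timelike and past-pointing on all of $M$. (B) For each inextendible timelike curve $\gamma:\mathbb R\to M$ parameterized by $t$ (that is, $t(\gamma(s))=s$), $\lim_{s\to\pm\infty}\mathcal T(\gamma(s))=\pm\infty$. (C) Each level $\mathcal T^{-1}(c)$, $c\in\mathbb R$, is a smooth embedded spacelike Cauchy hypersurface. (D) Put $\mathcal S=\mathcal T^{-1}(0)$, with its structure of embedded smooth hypersurface. There are a diffeomorphism $\Psi:\mathbb R\times\mathcal S\to M$ with $\mathcal T(\Psi(s,x))=s$ and $\Psi(0,x)=x$, a smooth function $\beta:\mathbb R\times\mathcal S\to(0,\infty)$, and a smooth symmetric $2$-covariant tensor field $\bar g$ on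 $\mathbb R\times\mathcal S$ such that, writing $\mathcal T$ also for the projection $\mathbb R\times\mathcal S\to\mathbb R$, $$\Psi^*g=-\beta\,d\mathcal T^2+\bar g ,$$ the restriction of $\bar g$ to each slice $\{s\}\times\mathcal S$ is a Riemannian metric, and the radical of $\bar g$ at each point $w$ is the line spanned by $\partial_{\mathcal T}$, which is also the line of vectors that $d\Psi_w$ maps into $\operatorname{Span}(\nabla\mathcal T(\Psi(w)))$. -/

import Mathlib

open Set Bundle Filter
open scoped Manifold ContDiff Topology

/-- The data `(g, X)` of a time-oriented Lorentzian manifold of dimension `m + 1`: a smooth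
symmetric 2-tensor `g` of signature `(-, +, ..., +)` on the smooth manifold `M`, and a smooth
timelike vector field `X`, which fixes the time orientation (the future cone is the one
containing `X`). -/
structure Spacetime (m : ℕ) (M : Type*) [TopologicalSpace M]
    [ChartedSpace (EuclideanSpace ℝ (Fin (m + 1))) M] [IsManifold (𝓡 (m + 1)) ∞ M] where
  /-- The metric tensor. -/
  metric (x : M) : TangentSpace (𝓡 (m + 1)) x →L[ℝ] TangentSpace (𝓡 (m + 1)) x →L[ℝ] ℝ
  symm (x : M) (v w : TangentSpace (𝓡 (m + 1)) x) : metric x v w = metric x w v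
  /-- Signature `(-, +, ..., +)`: some negative vector has a positive definite orthogonal
  complement. -/
  signature (x : M) : ∃ v : TangentSpace (𝓡 (m + 1)) x, metric x v v < 0 ∧
    ∀ w : TangentSpace (𝓡 (m + 1)) x, metric x v w = 0 → w ≠ 0 → 0 < metric x w w
  contMDiff_metric : ContMDiff (𝓡 (m + 1))
    ((𝓡 (m + 1)).prod 𝓘(ℝ, EuclideanSpace ℝ (Fin (m + 1)) →L[ℝ]
      EuclideanSpace ℝ (Fin (m + 1)) →L[ℝ] ℝ)) ∞
    (fun x ↦ TotalSpace.mk' (EuclideanSpace ℝ (Fin (m + 1)) →L[ℝ]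
      EuclideanSpace ℝ (Fin (m + 1)) →L[ℝ] ℝ) x (metric x))
  /-- The vector field giving the time orientation. -/
  timeField (x : M) : TangentSpace (𝓡 (m + 1)) x
  timelike_timeField (x : M) : metric x (timeField x) (timeField x) < 0
  contMDiff_timeField : ContMDiff (𝓡 (m + 1)) (𝓡 (m + 1)).tangent ∞
    (fun x ↦ (⟨x, timeField x⟩ : TangentBundle (𝓡 (m + 1)) M))

namespace Spacetime

/-- A bilinear form of signature `(-, +, ..., +)` represents every covector uniquely. -/
theorem existsUnique_bilin_eq {V : Type*} [AddCommGroup V] [Module ℝ V] [TopologicalSpace V]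
    [IsTopologicalAddGroup V] [ContinuousSMul ℝ V] [FiniteDimensional ℝ V]
    (B : V →L[ℝ] V →L[ℝ] ℝ) (hs : ∀ v w, B v w = B w v)
    (hB : ∃ v, B v v < 0 ∧ ∀ w, B v w = 0 → w ≠ 0 → 0 < B w w) (α : V →L[ℝ] ℝ) :
    ∃! v, ∀ w, B v w = α w := by
  have hinj : ∀ v, (∀ w, B v w = 0) → v = 0 := by
    intro v hv
    obtain ⟨u, -, hu⟩ := hB
    by_contra hne
    have h := hu v (by rw [hs]; exact hv u) hne
    rw [hv v] at h
    exact lt_irrefl _ h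
  let φ : V →ₗ[ℝ] (V →ₗ[ℝ] ℝ) := LinearMap.mk₂ ℝ (fun v w ↦ B v w)
    (by intros; simp) (by intros; simp) (by intros; simp) (by intros; simp)
  have hφ : Function.Injective φ := by
    rw [injective_iff_map_eq_zero]
    exact fun v hv ↦ hinj v fun w ↦ LinearMap.congr_fun hv w
  have hdim : Module.finrank ℝ V = Module.finrank ℝ (V →ₗ[ℝ] ℝ) :=
    (Subspace.dual_finrank_eq (K := ℝ) (V := V)).symm
  obtain ⟨v, hv⟩ := (LinearMap.injective_iff_surjective_of_finrank_eq_finrank hdim).1 hφ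
    α.toLinearMap
  have h2 : ∀ w, B v w = α w := fun w ↦ LinearMap.congr_fun hv w
  refine ⟨v, h2, fun v' hv' ↦ sub_eq_zero.1 (hinj (v' - v) fun w ↦ ?_)⟩
  rw [map_sub, sub_apply, hv' w, h2 w, sub_self]

variable {m : ℕ} {M : Type*} [TopologicalSpace M]
  [ChartedSpace (EuclideanSpace ℝ (Fin (m + 1))) M] [IsManifold (𝓡 (m + 1)) ∞ M]
  (g : Spacetime m M)

/-- The metric is nondegenerate: every covector is `g(v, ·)` for a unique `v`. -/
theorem existsUnique_metric_eq (x : M) (α : TangentSpace (𝓡 (m + 1)) x →L[ℝ] ℝ) :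
    ∃! v : TangentSpace (𝓡 (m + 1)) x, ∀ w, g.metric x v w = α w :=
  haveI : FiniteDimensional ℝ (TangentSpace (𝓡 (m + 1)) x) :=
    inferInstanceAs (FiniteDimensional ℝ (EuclideanSpace ℝ (Fin (m + 1))))
  existsUnique_bilin_eq (g.metric x) (g.symm x) (g.signature x) α

/-- The gradient `∇f` of `f` at `x`: the vector metrically equivalent to `df`. -/
noncomputable def grad (f : M → ℝ) (x : M) : TangentSpace (𝓡 (m + 1)) x :=
  (g.existsUnique_metric_eq x (mfderiv (𝓡 (m + 1)) 𝓘(ℝ, ℝ) f x)).choose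

theorem metric_grad (f : M → ℝ) (x : M) (w : TangentSpace (𝓡 (m + 1)) x) :
    g.metric x (g.grad f x) w = mfderiv (𝓡 (m + 1)) 𝓘(ℝ, ℝ) f x w :=
  (g.existsUnique_metric_eq x (mfderiv (𝓡 (m + 1)) 𝓘(ℝ, ℝ) f x)).choose_spec.1 w

/-- Future-pointing timelike tangent vectors. -/
def FutureTimelike {x : M} (v : TangentSpace (𝓡 (m + 1)) x) : Prop :=
  g.metric x v v < 0 ∧ g.metric x v (g.timeField x) < 0

/-- Past-pointing timelike tangent vectors. -/
def PastTimelike {x : M} (v : TangentSpace (𝓡 (m + 1)) x) : Prop :=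
  g.metric x v v < 0 ∧ 0 < g.metric x v (g.timeField x)

/-- Future-pointing causal (i.e. nonzero, timelike or lightlike) tangent vectors. -/
def FutureCausal {x : M} (v : TangentSpace (𝓡 (m + 1)) x) : Prop :=
  v ≠ 0 ∧ g.metric x v v ≤ 0 ∧ g.metric x v (g.timeField x) < 0

/-- `γ` restricts to a smooth future-directed timelike curve on the interval `[a, b]`. -/
def IsTimelikeSegment (γ : ℝ → M) (a b : ℝ) : Prop :=
  a < b ∧ ContMDiffOn 𝓘(ℝ, ℝ) (𝓡 (m + 1)) ∞ γ (Icc a b) ∧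
    ∀ s ∈ Icc a b, g.FutureTimelike (x := γ s)
      (mfderivWithin 𝓘(ℝ, ℝ) (𝓡 (m + 1)) γ (Icc a b) s (1 : ℝ))

/-- `γ` restricts to a smooth future-directed causal curve on the interval `[a, b]`. -/
def IsCausalSegment (γ : ℝ → M) (a b : ℝ) : Prop :=
  a < b ∧ ContMDiffOn 𝓘(ℝ, ℝ) (𝓡 (m + 1)) ∞ γ (Icc a b) ∧
    ∀ s ∈ Icc a b, g.FutureCausal (x := γ s)
      (mfderivWithin 𝓘(ℝ, ℝ) (𝓡 (m + 1)) γ (Icc a b) s (1 : ℝ))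

/-- The causal relation `p ≤ q`: either `p = q`, or there is a piecewise smooth future-directed
causal curve (a finite concatenation of smooth ones) from `p` to `q`. -/
def CausalLE : M → M → Prop :=
  Relation.ReflTransGen fun p q ↦ ∃ (γ : ℝ → M) (a b : ℝ),
    g.IsCausalSegment γ a b ∧ γ a = p ∧ γ b = q

/-- The causal future `J⁺(A)`. -/
def causalFuture (A : Set M) : Set M := {q | ∃ p ∈ A, g.CausalLE p q}

/-- The causal past `J⁻(A)`. -/
def causalPast (A : Set M) : Set M := {p | ∃ q ∈ A, g.CausalLE p q}

/-- Strong causality: every neighborhood `U` of a point contains a neighborhood `V` of the point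
such that causal curves with endpoints in `V` stay in `U`. -/
def StronglyCausal : Prop :=
  ∀ p : M, ∀ U ∈ 𝓝 p, ∃ V ∈ 𝓝 p, ∀ x ∈ V, ∀ z ∈ V, ∀ y : M,
    g.CausalLE x y → g.CausalLE y z → y ∈ U

/-- Global hyperbolicity. -/
def GloballyHyperbolic : Prop :=
  g.StronglyCausal ∧ ∀ p q : M, IsCompact (g.causalFuture {p} ∩ g.causalPast {q})

/-- `γ` restricts to an inextendible (piecewise smooth, future-directed) timelike curve on the
nonempty open interval `I`. Piecewise smoothness is expressed locally: `γ` is smooth on some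
interval `[s, s + ε]` and on some interval `[s - ε, s]` for each `s ∈ I`, so that the breaks
are isolated. Inextendibility means that `γ` converges to no point of `M` at either end of `I`. -/
structure IsInextendibleTimelikeCurve (I : Set ℝ) (γ : ℝ → M) : Prop where
  isOpen : IsOpen I
  ordConnected : I.OrdConnected
  nonempty : I.Nonempty
  timelike_right : ∀ s ∈ I, ∃ ε > 0, s + ε ∈ I ∧ g.IsTimelikeSegment γ s (s + ε)
  timelike_left : ∀ s ∈ I, ∃ ε > 0, s - ε ∈ I ∧ g.IsTimelikeSegment γ (s - ε) s
  no_future_endpoint : ∀ p : M, ¬ ∀ U ∈ 𝓝 p, ∃ s₀ ∈ I, ∀ s ∈ I, s₀ ≤ s → γ s ∈ U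
  no_past_endpoint : ∀ p : M, ¬ ∀ U ∈ 𝓝 p, ∃ s₀ ∈ I, ∀ s ∈ I, s ≤ s₀ → γ s ∈ U

/-- Cauchy hypersurfaces: subsets crossed exactly once by each inextendible timelike curve. -/
def IsCauchy (S : Set M) : Prop :=
  ∀ (I : Set ℝ) (γ : ℝ → M), g.IsInextendibleTimelikeCurve I γ → ∃! s, s ∈ I ∧ γ s ∈ S

/-- Continuous Cauchy time functions: continuous surjective functions `t : M → ℝ`, strictly
increasing on future-directed causal curves, all of whose levels are Cauchy hypersurfaces. -/
structure IsCauchyTimeFunction (t : M → ℝ) : Prop where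
  continuous : Continuous t
  surjective : Function.Surjective t
  strictMonoOn : ∀ (γ : ℝ → M) (a b : ℝ), g.IsCausalSegment γ a b →
    StrictMonoOn (fun s ↦ t (γ s)) (Icc a b)
  isCauchy : ∀ c : ℝ, g.IsCauchy (t ⁻¹' {c})

/-- The support of the gradient of `τ`. -/
def gradSupport (τ : M → ℝ) : Set M := closure {x | g.grad τ x ≠ 0}

/-- `τ` is a temporal step function around `c` for the Cauchy time function `t`, compatible with
the outer extremes `c₁`, `c₂` and the inner extremes `a`, `b`. -/
structure IsTemporalStepFunction (t : M → ℝ) (c c₁ a b c₂ : ℝ) (τ : M → ℝ) : Prop where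
  extremes : c₁ < a ∧ a < c ∧ c < b ∧ b < c₂
  contMDiff : ContMDiff (𝓡 (m + 1)) 𝓘(ℝ, ℝ) ∞ τ
  pastTimelike_grad : ∀ x ∈ interior (g.gradSupport τ), g.PastTimelike (g.grad τ x)
  mem_Icc : ∀ x, τ x ∈ Icc (-1 : ℝ) 1
  eq_one : ∀ x ∈ g.causalFuture (t ⁻¹' {c₂}), τ x = 1
  eq_neg_one : ∀ x ∈ g.causalPast (t ⁻¹' {c₁}), τ x = -1
  level_subset : ∀ c' ∈ Ioo a b, t ⁻¹' {c'} ⊆ interior (g.gradSupport τ)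

/-- The smooth structure given on the subset `S` of `M` makes it an embedded spacelike
hypersurface (without boundary) of `M`: the inclusion is a smooth embedding, and the induced
metric is positive definite. -/
structure IsSpacelikeHypersurface (S : Set M) [ChartedSpace (EuclideanSpace ℝ (Fin m)) S] :
    Prop where
  isManifold : IsManifold (𝓡 m) ∞ S
  isSmoothEmbedding : Manifold.IsSmoothEmbedding (𝓡 m) (𝓡 (m + 1)) ∞ (Subtype.val : S → M)
  spacelike : ∀ (x : S) (v : TangentSpace (𝓡 m) x), v ≠ 0 →
    0 < g.metric (x : M) (mfderiv (𝓡 m) (𝓡 (m + 1)) (Subtype.val : S → M) x v)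
      (mfderiv (𝓡 m) (𝓡 (m + 1)) (Subtype.val : S → M) x v)

/-- The differential `d𝒯` of the projection `𝒯 : ℝ × S → ℝ`. -/
noncomputable def timeForm {S : Set M} [ChartedSpace (EuclideanSpace ℝ (Fin m)) S] (w : ℝ × S) :
    TangentSpace (𝓘(ℝ, ℝ).prod (𝓡 m)) w →L[ℝ] ℝ :=
  mfderiv (𝓘(ℝ, ℝ).prod (𝓡 m)) 𝓘(ℝ, ℝ) (Prod.fst : ℝ × S → ℝ) w

/-- `Ψ`, `β` and `h` form an orthogonal splitting of the spacetime `(M, g)` as the product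
`ℝ × S`, with metric `-β d𝒯² + h`, where `𝒯` is the projection onto `ℝ` and corresponds to the
function `T` on `M`, and `S ⊆ M` is identified with `{0} × S`. -/
structure IsOrthogonalSplitting (T : M → ℝ) (S : Set M)
    [ChartedSpace (EuclideanSpace ℝ (Fin m)) S] [IsManifold (𝓡 m) ∞ S]
    (Ψ : (ℝ × S) ≃ₘ^∞⟮𝓘(ℝ, ℝ).prod (𝓡 m), 𝓡 (m + 1)⟯ M) (β : ℝ × S → ℝ)
    (h : ∀ w : ℝ × S, TangentSpace (𝓘(ℝ, ℝ).prod (𝓡 m)) w →L[ℝ]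
      TangentSpace (𝓘(ℝ, ℝ).prod (𝓡 m)) w →L[ℝ] ℝ) : Prop where
  time_eq : ∀ w, T (Ψ w) = w.1
  initial : ∀ x : S, Ψ (0, x) = x
  lapse_pos : ∀ w, 0 < β w
  contMDiff_lapse : ContMDiff (𝓘(ℝ, ℝ).prod (𝓡 m)) 𝓘(ℝ, ℝ) ∞ β
  contMDiff_tensor : ContMDiff (𝓘(ℝ, ℝ).prod (𝓡 m))
    ((𝓘(ℝ, ℝ).prod (𝓡 m)).prod 𝓘(ℝ, (ℝ × EuclideanSpace ℝ (Fin m)) →L[ℝ]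
      (ℝ × EuclideanSpace ℝ (Fin m)) →L[ℝ] ℝ)) ∞
    (fun w ↦ TotalSpace.mk' ((ℝ × EuclideanSpace ℝ (Fin m)) →L[ℝ]
      (ℝ × EuclideanSpace ℝ (Fin m)) →L[ℝ] ℝ) w (h w))
  symm_tensor : ∀ w u v, h w u v = h w v u
  /-- `Ψ* g = -β d𝒯² + h`. -/
  metric_eq : ∀ (w : ℝ × S) (u v : TangentSpace (𝓘(ℝ, ℝ).prod (𝓡 m)) w),
    g.metric (Ψ w) (mfderiv (𝓘(ℝ, ℝ).prod (𝓡 m)) (𝓡 (m + 1)) Ψ w u)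
        (mfderiv (𝓘(ℝ, ℝ).prod (𝓡 m)) (𝓡 (m + 1)) Ψ w v) =
      -β w * (timeForm w u * timeForm w v) + h w u v
  /-- The restriction of `h` to each slice of constant `𝒯` is a Riemannian metric. -/
  pos_slice : ∀ (w : ℝ × S) (v : TangentSpace (𝓘(ℝ, ℝ).prod (𝓡 m)) w),
    timeForm w v = 0 → v ≠ 0 → 0 < h w v v
  /-- The radical of `h` is spanned by the coordinate vector field `∂_𝒯 = (1, 0)`. -/
  radical_coord : ∀ (w : ℝ × S) (u : TangentSpace (𝓘(ℝ, ℝ).prod (𝓡 m)) w),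
    (∀ v, h w u v = 0) ↔
      ∃ r : ℝ, u = r • (((1 : ℝ), (0 : EuclideanSpace ℝ (Fin m))) :
        TangentSpace (𝓘(ℝ, ℝ).prod (𝓡 m)) w)
  /-- The radical of `h` is spanned by the gradient of `𝒯`. -/
  radical_grad : ∀ (w : ℝ × S) (u : TangentSpace (𝓘(ℝ, ℝ).prod (𝓡 m)) w),
    (∀ v, h w u v = 0) ↔
      ∃ r : ℝ, mfderiv (𝓘(ℝ, ℝ).prod (𝓡 m)) (𝓡 (m + 1)) Ψ w u = r • g.grad T (Ψ w)

end Spacetime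

/-! Why it is true. Fix an integer `n`. The open intervals of inner extremes cover the compact
interval `[n, n + 1]` of values of `t`, so finitely many temporal step functions centred there have
a sum whose gradient is timelike and past-pointing on the whole slab `n ≤ t ≤ n + 1`: on that slab
some summand has a timelike gradient, the others have a gradient which is zero or in the same cone,
and the cone is convex. Because the outer extremes are at distance 2 from the centres, the sum is
constant for `t ≤ n - 2` and for `t ≥ n + 3`. Only compactness in `ℝ` is used; the levels of `t` may
be noncompact.

Adding a constant makes the sum vanish in the past when `n ≥ 0` and in the future when `n < 0`. The
series over all `n` is then locally finite, has a past-pointing timelike gradient everywhere, and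
tends to `±∞` with `t` (`exists_temporalFunction`). Every inextendible timelike curve meets all
levels of `t`, so `T` takes every value on it, and exactly once by monotonicity. This gives the
divergence along timelike curves and the Cauchy property. The levels are regular and orthogonal to a
timelike vector, hence embedded and spacelike.

For the splitting, let `X = ∇T / g(∇T, ∇T)` (`unitGrad`). It is future timelike and `dT(X) = 1`, so
along a maximal integral curve `T` is the parameter up to a constant. Such a curve is an
inextendible timelike curve and `T` is onto `ℝ` along it, so the curve is complete. The global flow
of `X`, started on `T = 0`, is the diffeomorphism `Ψ`. With `β = -1 / g(∇T, ∇T)`, the tensor `Ψ* g +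
β dT²` kills `∂_𝒯` because `X` is proportional to `∇T`, and it is positive on the slices because
these are orthogonal to `∇T`.

The analytic support is a smooth local flow, obtained from the inverse function theorem in `C([0,
1], E)` (`exists_contDiffOn_localFlow`), maximal integral curves without endpoints
(`exists_inextendible_integralCurve`), a smooth global flow for complete fields
(`exists_contMDiff_flow`), and the manifold structure of regular levels
(`exists_chartedSpace_levelSet`). -/

/-! ### Superposition operators on spaces of continuous functions. -/

section Nemytskii

variable {K : Type*} [TopologicalSpace K] [CompactSpace K]

variable {E F G : Type*} [NormedAddCommGroup E] [NormedSpace ℝ E] [NormedAddCommGroup F]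
  [NormedSpace ℝ F] [NormedAddCommGroup G] [NormedSpace ℝ G]

/-- The pointwise extension of a bilinear map to continuous functions on a compact space. -/
noncomputable def ContinuousMap.pointwiseBilin (K : Type*) [TopologicalSpace K] [CompactSpace K]
    (B : G →L[ℝ] E →L[ℝ] F) : C(K, G) →L[ℝ] C(K, E) →L[ℝ] C(K, F) :=
  LinearMap.mkContinuous₂
    (LinearMap.mk₂ ℝ (fun (A : C(K, G)) (η : C(K, E)) ↦
        (⟨fun k ↦ B (A k) (η k), (B.continuous.comp A.continuous).clm_apply η.continuous⟩ : C(K, F)))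
      (by intros; ext; simp) (by intros; ext; simp) (by intros; ext; simp)
      (by intros; ext; simp)) ‖B‖ (by
    intro A η
    refine (ContinuousMap.norm_le _ (by positivity)).2 fun k ↦ ?_
    refine (B.le_opNorm₂ _ _).trans ?_
    gcongr
    · exact A.norm_coe_le_norm k
    · exact η.norm_coe_le_norm k)

/-- Composition with a `C¹` map is differentiable on spaces of continuous functions. -/
theorem hasFDerivAt_postcomp (B : G →L[ℝ] E →L[ℝ] F) (f : C(E, F)) (f' : C(E, G))
    (hf : ∀ x, HasFDerivAt f (B (f' x)) x) (γ : C(K, E)) :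
    HasFDerivAt (fun γ : C(K, E) ↦ f.comp γ)
      (ContinuousMap.pointwiseBilin K B (f'.comp γ)) γ := by
  rw [hasFDerivAt_iff_isLittleO_nhds_zero, Asymptotics.isLittleO_iff]
  intro c hc
  have hcont := (ContinuousMap.continuous_postcomp (X := K) f').continuousAt (x := γ)
  rw [Metric.continuousAt_iff] at hcont
  obtain ⟨c', hc', hcc⟩ : ∃ c' > 0, ‖B‖ * c' ≤ c :=
    ⟨c / (‖B‖ + 1), by positivity, by
      rw [← mul_div_assoc, div_le_iff₀ (by positivity)]; nlinarith [norm_nonneg B]⟩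
  obtain ⟨δ, hδ, H⟩ := hcont c' hc'
  filter_upwards [Metric.ball_mem_nhds (0 : C(K, E)) hδ] with η hη
  rw [mem_ball_zero_iff] at hη
  refine (ContinuousMap.norm_le _ (by positivity)).2 fun k ↦ ?_
  have key : ∀ z ∈ Metric.ball (γ k) δ, ‖B (f' z) - B (f' (γ k))‖ ≤ c := by
    intro z hz
    rw [mem_ball_iff_norm] at hz
    -- The same `δ` serves every `k`: continuity of `γ ↦ f' ∘ γ` in the sup norm is tested on the
    -- translate of `γ` by a constant, chosen to take the value `z` at `k`.
    have h1 : dist (γ + ContinuousMap.const K (z - γ k)) γ < δ := by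
      rw [dist_eq_norm, add_sub_cancel_left]
      exact ((ContinuousMap.norm_lt_iff _ hδ).2 fun _ ↦ hz)
    have h3 := (ContinuousMap.dist_apply_le_dist k).trans (H h1).le
    have h4 : ‖f' z - f' (γ k)‖ ≤ c' := by simpa [dist_eq_norm] using h3
    rw [← map_sub]
    exact (B.le_opNorm _).trans ((mul_le_mul_of_nonneg_left h4 (norm_nonneg _)).trans hcc)
  have := (convex_ball (γ k) δ).norm_image_sub_le_of_norm_hasFDerivWithin_le'
    (f := f) (f' := fun z ↦ B (f' z)) (φ := B (f' (γ k)))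
    (fun z _ ↦ (hf z).hasFDerivWithinAt) key
    (Metric.mem_ball_self hδ) (y := γ k + η k) (by
      rw [mem_ball_iff_norm, add_sub_cancel_left]
      exact (η.norm_coe_le_norm k).trans_lt hη)
  simp only [add_sub_cancel_left] at this
  exact this.trans (mul_le_mul_of_nonneg_left (η.norm_coe_le_norm k) hc.le)

theorem ContDiff.postcomp_succ {n : ℕ} (B : G →L[ℝ] E →L[ℝ] F) (f : C(E, F)) (f' : C(E, G))
    (hf : ∀ x, HasFDerivAt f (B (f' x)) x) (hf' : ContDiff ℝ n (fun γ : C(K, E) ↦ f'.comp γ)) :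
    ContDiff ℝ (n + 1) (fun γ : C(K, E) ↦ f.comp γ) :=
  contDiff_succ_iff_hasFDerivAt.2 ⟨fun γ ↦ ContinuousMap.pointwiseBilin K B (f'.comp γ),
      (ContinuousMap.pointwiseBilin K B).contDiff.comp hf', hasFDerivAt_postcomp B f f' hf⟩

universe u

/-- The derivative of composition with `f` is composition with `fderiv ℝ f` followed by a bounded
bilinear map, so induction on `n` works once the target `F` varies: the next target is `E →L[ℝ] F`,
which is why both spaces share a universe. -/
theorem contDiff_postcomp_nat {E : Type u} [NormedAddCommGroup E] [NormedSpace ℝ E] (n : ℕ) :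
    ∀ {F : Type u} [NormedAddCommGroup F] [NormedSpace ℝ F] (f : C(E, F)),
      ContDiff ℝ n f → ContDiff ℝ n (fun γ : C(K, E) ↦ f.comp γ) := by
  induction n with
  | zero =>
    intro F _ _ f _
    exact contDiff_zero.2 (ContinuousMap.continuous_postcomp f)
  | succ n ih =>
    intro F _ _ f hf
    have hf' : ContDiff ℝ n (fderiv ℝ f) :=
      hf.fderiv_right (m := (n : WithTop ℕ∞)) (by norm_cast)
    have hd : Differentiable ℝ f := hf.differentiable (by norm_cast)
    push_cast
    exact ContDiff.postcomp_succ (G := E →L[ℝ] F) (ContinuousLinearMap.id ℝ _) f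
      ⟨fderiv ℝ f, hf'.continuous⟩ (fun x ↦ (hd x).hasFDerivAt) (ih _ hf')

/-- Composition with a smooth map is a smooth operator on spaces of continuous functions. -/
theorem contDiff_postcomp {E F : Type u} [NormedAddCommGroup E] [NormedSpace ℝ E]
    [NormedAddCommGroup F] [NormedSpace ℝ F] (f : C(E, F)) (hf : ContDiff ℝ ∞ f) :
    ContDiff ℝ ∞ (fun γ : C(K, E) ↦ f.comp γ) :=
  contDiff_infty.2 fun n ↦ contDiff_postcomp_nat n f (contDiff_infty.1 hf n)

end Nemytskii

/-! ### Smooth local flows in a normed space. -/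

section LocalFlow

universe u

variable {E : Type u} [NormedAddCommGroup E] [NormedSpace ℝ E]

/-- The primitive vanishing at `0` of a continuous curve on the unit interval. -/
noncomputable def unitIntervalPrimitive (E : Type*) [NormedAddCommGroup E] [NormedSpace ℝ E] :
    C(unitInterval, E) →L[ℝ] C(unitInterval, E) :=
  LinearMap.mkContinuous
    { toFun := fun η ↦ ⟨fun τ ↦ ∫ r in (0 : ℝ)..τ, Set.IccExtend zero_le_one η r,
        (intervalIntegral.continuous_primitive (fun a b ↦
          (η.continuous.Icc_extend' (h := zero_le_one)).intervalIntegrable a b) 0).comp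
          continuous_subtype_val⟩
      map_add' := fun η ζ ↦ by
        ext τ
        exact intervalIntegral.integral_add
          ((η.continuous.Icc_extend' (h := zero_le_one)).intervalIntegrable _ _)
          ((ζ.continuous.Icc_extend' (h := zero_le_one)).intervalIntegrable _ _)
      map_smul' := fun c η ↦ by
        ext τ
        exact intervalIntegral.integral_smul c _ } 1 (by
    intro η
    rw [one_mul]
    refine (ContinuousMap.norm_le _ (norm_nonneg _)).2 fun τ ↦ ?_
    refine (intervalIntegral.norm_integral_le_of_norm_le_const
      (C := ‖η‖) fun r _ ↦ η.norm_coe_le_norm _).trans ?_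
    rw [sub_zero, abs_of_nonneg τ.2.1]
    exact mul_le_of_le_one_right (norm_nonneg _) τ.2.2)

/-- The shear `(l, x, γ) ↦ (l, x, γ - x - l • u)` of `ℝ × E × C([0,1], E)`. -/
noncomputable def flowShear (u : C(unitInterval, E)) :
    (ℝ × E × C(unitInterval, E)) ≃L[ℝ] (ℝ × E × C(unitInterval, E)) :=
  ContinuousLinearEquiv.equivOfInverse
    ((ContinuousLinearMap.fst ℝ ℝ _).prod
      (((ContinuousLinearMap.fst ℝ E _).comp (ContinuousLinearMap.snd ℝ ℝ _)).prod
      ((ContinuousLinearMap.snd ℝ E _).comp (ContinuousLinearMap.snd ℝ ℝ _) -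
        (ContinuousLinearMap.const (R := ℝ) (M := E) unitInterval).comp
          ((ContinuousLinearMap.fst ℝ E _).comp (ContinuousLinearMap.snd ℝ ℝ _)) -
        (ContinuousLinearMap.fst ℝ ℝ (E × C(unitInterval, E))).smulRight u)))
    ((ContinuousLinearMap.fst ℝ ℝ _).prod
      (((ContinuousLinearMap.fst ℝ E _).comp (ContinuousLinearMap.snd ℝ ℝ _)).prod
      ((ContinuousLinearMap.snd ℝ E _).comp (ContinuousLinearMap.snd ℝ ℝ _) +
        (ContinuousLinearMap.const (R := ℝ) (M := E) unitInterval).comp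
          ((ContinuousLinearMap.fst ℝ E _).comp (ContinuousLinearMap.snd ℝ ℝ _)) +
        (ContinuousLinearMap.fst ℝ ℝ (E × C(unitInterval, E))).smulRight u)))
    (fun p ↦ by ext <;> simp; abel) (fun p ↦ by ext <;> simp; abel)

theorem flowShear_apply (u : C(unitInterval, E)) (p : ℝ × E × C(unitInterval, E)) :
    flowShear u p = (p.1, p.2.1, p.2.2 - ContinuousMap.const _ p.2.1 - p.1 • u) := rfl

/-- The integral equation of the rescaled flow of `f`: its zeros (in the last component) are the
solutions `γ` on `[0, 1]` of `γ' = l f(γ)`, `γ(0) = x`. -/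
noncomputable def flowEquation (f : C(E, E)) (p : ℝ × E × C(unitInterval, E)) :
    ℝ × E × C(unitInterval, E) :=
  (p.1, p.2.1, p.2.2 - ContinuousLinearMap.const (R := ℝ) unitInterval p.2.1 -
    p.1 • unitIntervalPrimitive E (f.comp p.2.2))

theorem contDiff_flowEquation (f : C(E, E)) (hf : ContDiff ℝ ∞ f) :
    ContDiff ℝ ∞ (flowEquation f) := by
  have h1 : ContDiff ℝ ∞ (fun p : ℝ × E × C(unitInterval, E) ↦
      unitIntervalPrimitive E (f.comp p.2.2)) :=
    (unitIntervalPrimitive E).contDiff.comp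
      ((contDiff_postcomp f hf).comp (contDiff_snd.comp contDiff_snd))
  have h2 : ContDiff ℝ ∞ (fun p : ℝ × E × C(unitInterval, E) ↦
      ContinuousLinearMap.const (R := ℝ) unitInterval p.2.1) :=
    (ContinuousLinearMap.const (R := ℝ) (M := E) unitInterval).contDiff.comp
      (contDiff_fst.comp contDiff_snd)
  exact contDiff_fst.prodMk ((contDiff_fst.comp contDiff_snd).prodMk
    (((contDiff_snd.comp contDiff_snd).sub h2).sub (contDiff_fst.smul h1)))

/-- At rescaled time `l = 0` the term `l • P(f ∘ γ)` contributes only in the direction of `l`, so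
the derivative of `f` drops out and the differential is a shear. It is invertible without any
smallness estimate. -/
theorem hasFDerivAt_flowEquation (f : C(E, E)) (hf : ContDiff ℝ ∞ f) (x : E)
    (γ : C(unitInterval, E)) :
    HasFDerivAt (flowEquation f)
      (flowShear (unitIntervalPrimitive E (f.comp γ)) : _ →L[ℝ] ℝ × E × C(unitInterval, E))
      (0, x, γ) := by
  set p₀ : ℝ × E × C(unitInterval, E) := (0, x, γ)
  have h1 : DifferentiableAt ℝ (fun p : ℝ × E × C(unitInterval, E) ↦
      unitIntervalPrimitive E (f.comp p.2.2)) p₀ :=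
    ((unitIntervalPrimitive E).contDiff.comp
      ((contDiff_postcomp f hf).comp (contDiff_snd.comp contDiff_snd))).differentiable
        (by simp : (∞ : WithTop ℕ∞) ≠ 0) p₀
  have hs := (hasFDerivAt_fst (𝕜 := ℝ) (p := p₀)).smul h1.hasFDerivAt
  have h2 := ((ContinuousLinearMap.const (R := ℝ) (M := E) unitInterval).hasFDerivAt
    (x := p₀.2.1)).comp p₀ ((ContinuousLinearMap.fst ℝ E C(unitInterval, E)).hasFDerivAt.comp p₀
      (hasFDerivAt_snd (𝕜 := ℝ) (p := p₀)))
  have h3 := (ContinuousLinearMap.snd ℝ E C(unitInterval, E)).hasFDerivAt.comp p₀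
      (hasFDerivAt_snd (𝕜 := ℝ) (p := p₀))
  have h4 := (ContinuousLinearMap.fst ℝ E C(unitInterval, E)).hasFDerivAt.comp p₀
      (hasFDerivAt_snd (𝕜 := ℝ) (p := p₀))
  have := (hasFDerivAt_fst (𝕜 := ℝ) (p := p₀)).prodMk (h4.prodMk ((h3.sub h2).sub hs))
  refine this.congr_fderiv ?_
  ext p <;> simp [flowShear_apply, p₀]

/-- **Smooth dependence on initial conditions**: a smooth vector field has a smooth local flow. -/
theorem exists_contDiffOn_localFlow [CompleteSpace E] (f : E → E) (hf : ContDiff ℝ ∞ f) (x₀ : E) :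
    ∃ ε > 0, ∃ r > 0, ∃ α : ℝ × E → E, (∀ x ∈ Metric.ball x₀ r, α (0, x) = x ∧
      ∀ s ∈ Ioo (-ε) ε, HasDerivAt (fun s ↦ α (s, x)) (f (α (s, x))) s) ∧
      ContDiffOn ℝ ∞ α (Ioo (-ε) ε ×ˢ Metric.ball x₀ r) := by
  -- Picard–Lindelöf gives a continuous family of solutions. Local injectivity of `flowEquation`
  -- identifies it with the smooth local inverse, which transfers smoothness to it.
  obtain ⟨ε₁, hε₁, a, r₁, L, K, hr₁, hPL⟩ :=
    IsPicardLindelof.of_contDiffAt_one (hf.contDiffAt (x := x₀).of_le (by simp))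
  obtain ⟨α, hα, hαc⟩ :=
    (hPL 0).exists_forall_mem_closedBall_eq_hasDerivWithinAt_continuousOn
  simp only [zero_sub, zero_add] at hα hαc
  have hr₁' : (0 : ℝ) < r₁ := hr₁
  let fc : C(E, E) := ⟨f, hf.continuous⟩
  let γ₀ : C(unitInterval, E) := ContinuousMap.const _ x₀
  let p₀ : ℝ × E × C(unitInterval, E) := (0, x₀, γ₀)
  have hG := contDiff_flowEquation fc hf
  have hG' := hasFDerivAt_flowEquation fc hf x₀ γ₀
  let Φ := (hG.contDiffAt (x := p₀)).toOpenPartialHomeomorph (flowEquation fc) hG' (by simp)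
  have hΦ : ∀ p, Φ p = flowEquation fc p := fun _ ↦ rfl
  -- Smoothness of the inverse is needed on a neighborhood, hence the derivative must be invertible
  -- near `p₀`; invertible operators form a neighborhood of each of their points.
  have hgood : ∀ᶠ p in 𝓝 p₀, p ∈ Φ.source ∧ ∃ e : (ℝ × E × C(unitInterval, E)) ≃L[ℝ]
      (ℝ × E × C(unitInterval, E)),
      HasFDerivAt (flowEquation fc) (e : _ →L[ℝ] ℝ × E × C(unitInterval, E)) p := by
    have h0 : ∀ᶠ p in 𝓝 p₀, p ∈ Φ.source := Φ.open_source.mem_nhds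
      (ContDiffAt.mem_toOpenPartialHomeomorph_source (hG.contDiffAt (x := p₀)) hG' (by simp))
    refine h0.and ?_
    have hc : ContinuousAt (fderiv ℝ (flowEquation fc)) p₀ :=
      (hG.continuous_fderiv (by simp)).continuousAt
    have := hc.preimage_mem_nhds (by rw [hG'.fderiv]; exact ContinuousLinearEquiv.nhds _)
    filter_upwards [this] with p hp
    obtain ⟨e, he⟩ := hp
    refine ⟨e, ?_⟩
    rw [he]
    exact (hG.differentiable (by simp) p).hasFDerivAt
  obtain ⟨δ, hδ, hball⟩ := Metric.eventually_nhds_iff_ball.1 hgood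
  have hα0 : α (x₀, 0) = x₀ := (hα x₀ (Metric.mem_closedBall_self hr₁'.le)).1
  have hαat : ContinuousAt α (x₀, 0) := hαc.continuousAt
    (prod_mem_nhds (Metric.closedBall_mem_nhds x₀ hr₁') (Icc_mem_nhds (by linarith) hε₁))
  obtain ⟨δ', hδ', hα'⟩ := Metric.continuousAt_iff.1 hαat (δ / 2) (by linarith)
  rw [hα0] at hα'
  let ε := min ε₁ (min δ δ')
  let r : ℝ := min (r₁ : ℝ) (min δ δ')
  have hε : 0 < ε := by positivity
  have hr : 0 < r := by positivity
  have hderiv : ∀ x ∈ Metric.ball x₀ r, ∀ s ∈ Ioo (-ε) ε,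
      HasDerivAt (fun s ↦ α (x, s)) (f (α (x, s))) s := by
    intro x hx s hs
    have h1 : x ∈ Metric.closedBall x₀ r₁ :=
      Metric.ball_subset_closedBall (Metric.ball_subset_ball (min_le_left _ _) hx)
    have hεε : ε ≤ ε₁ := min_le_left _ _
    exact ((hα x h1).2 s ⟨by linarith [hs.1], by linarith [hs.2]⟩).hasDerivAt
      (Icc_mem_nhds (by linarith [hs.1]) (by linarith [hs.2]))
  have hsol : ∀ s ∈ Ioo (-ε) ε, ∀ x ∈ Metric.ball x₀ r,
      ((s, x, (0 : C(unitInterval, E))) ∈ Φ.target ∧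
        ContDiffAt ℝ ∞ Φ.symm (s, x, (0 : C(unitInterval, E)))) ∧
        α (x, s) = (Φ.symm (s, x, (0 : C(unitInterval, E)))).2.2 1 := by
    intro s hs x hx
    have hmul : ∀ τ : ℝ, τ ∈ Icc (0 : ℝ) 1 → s * τ ∈ Ioo (-ε) ε := by
      intro τ hτ
      rw [mem_Ioo, ← abs_lt] at hs ⊢
      rw [abs_mul, abs_of_nonneg hτ.1]
      exact (mul_le_of_le_one_right (abs_nonneg _) hτ.2).trans_lt hs
    have hcont : ContinuousOn (fun τ : ℝ ↦ α (x, s * τ)) (Icc 0 1) := fun τ hτ ↦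
      ((hderiv x hx _ (hmul τ hτ)).continuousAt.comp (f := fun τ : ℝ ↦ s * τ)
        (by fun_prop)).continuousWithinAt
    let γ : C(unitInterval, E) := ⟨fun τ ↦ α (x, s * τ), continuousOn_iff_continuous_domRestrict.1 hcont⟩
    have hxr : dist x x₀ < r := hx
    have hnear : (s, x, γ) ∈ Metric.ball p₀ δ := by
      rw [Metric.mem_ball, Prod.dist_eq, Prod.dist_eq, max_lt_iff, max_lt_iff]
      refine ⟨?_, ?_, ?_⟩
      · change dist s 0 < δ
        rw [Real.dist_0_eq_abs]
        exact (abs_lt.2 hs).trans_le ((min_le_right _ _).trans (min_le_left _ _))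
      · exact hxr.trans_le ((min_le_right _ _).trans (min_le_left _ _))
      · change dist γ γ₀ < δ
        refine lt_of_le_of_lt ((ContinuousMap.dist_le (by linarith : 0 ≤ δ / 2)).2 fun τ ↦ ?_)
          (by linarith : δ / 2 < δ)
        refine (hα' (x := (x, s * τ)) ?_).le
        rw [Prod.dist_eq, max_lt_iff]
        refine ⟨hxr.trans_le ((min_le_right _ _).trans (min_le_right _ _)), ?_⟩
        change dist (s * (τ : ℝ)) 0 < δ'
        rw [Real.dist_0_eq_abs]
        exact (abs_lt.2 (hmul τ τ.2)).trans_le ((min_le_right _ _).trans (min_le_right _ _))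
    obtain ⟨hsrc, e, he⟩ := hball _ hnear
    -- The rescaled curve `τ ↦ α (x, s τ)` solves the integral equation, by the fundamental theorem
    -- of calculus.
    have hzero : Φ (s, x, γ) = (s, x, 0) := by
      rw [hΦ]
      refine Prod.ext rfl (Prod.ext rfl ?_)
      ext τ
      change α (x, s * τ) - x - s • ∫ r in (0 : ℝ)..τ, Set.IccExtend zero_le_one (fc.comp γ) r = 0
      have hI : ∫ r in (0 : ℝ)..τ, s • f (α (x, s * r)) = α (x, s * τ) - α (x, s * 0) := by
        refine intervalIntegral.integral_eq_sub_of_hasDerivAt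
          (f := fun r : ℝ ↦ α (x, s * r)) ?_ ?_
        · intro r hr
          rw [uIcc_of_le τ.2.1] at hr
          have h1 := hderiv x hx _ (hmul r ⟨hr.1, hr.2.trans τ.2.2⟩)
          have h2 : HasDerivAt (fun r : ℝ ↦ s * r) s r := by
            simpa using (hasDerivAt_id r).const_mul s
          exact h1.scomp r h2
        · apply ContinuousOn.intervalIntegrable
          rw [uIcc_of_le τ.2.1]
          exact ((hf.continuous.comp_continuousOn hcont).const_smul s).mono
            (Icc_subset_Icc_right τ.2.2)
      rw [mul_zero, (hα x (Metric.ball_subset_closedBall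
        (Metric.ball_subset_ball (min_le_left _ _) hx))).1] at hI
      rw [← intervalIntegral.integral_smul, ← hI, sub_eq_zero]
      refine intervalIntegral.integral_congr fun r hr ↦ ?_
      rw [uIcc_of_le τ.2.1] at hr
      have hr' : r ∈ Icc (0 : ℝ) 1 := ⟨hr.1, hr.2.trans τ.2.2⟩
      simp only [IccExtend_of_mem _ _ hr']
      rfl
    have hinv : Φ.symm (s, x, 0) = (s, x, γ) := by rw [← hzero, Φ.left_inv hsrc]
    have htgt : (s, x, (0 : C(unitInterval, E))) ∈ Φ.target := hzero ▸ Φ.map_source hsrc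
    refine ⟨⟨htgt, Φ.contDiffAt_symm (f₀' := e) htgt (by rw [hinv]; exact he)
      (by rw [hinv]; exact hG.contDiffAt)⟩, ?_⟩
    rw [hinv]
    change α (x, s) = α (x, s * 1)
    rw [mul_one]
  refine ⟨ε, hε, r, hr, fun p ↦ α (p.2, p.1), fun x hx ↦ ⟨?_, hderiv x hx⟩, ?_⟩
  · exact (hα x (Metric.ball_subset_closedBall
      (Metric.ball_subset_ball (min_le_left _ _) hx))).1
  · have hcd : ContDiffOn ℝ ∞ (fun p : ℝ × E ↦
        ContinuousMap.evalCLM ℝ (1 : unitInterval) (Φ.symm (p.1, p.2, 0)).2.2)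
        (Ioo (-ε) ε ×ˢ Metric.ball x₀ r) := by
      intro p hp
      have h1 := (hsol p.1 hp.1 p.2 hp.2).1.2
      have h2 : ContDiffAt ℝ ∞ (fun p : ℝ × E ↦ (p.1, p.2, (0 : C(unitInterval, E)))) p :=
        contDiffAt_fst.prodMk (contDiffAt_snd.prodMk contDiffAt_const)
      exact ((ContinuousMap.evalCLM ℝ (1 : unitInterval)).contDiff.contDiffAt.comp p
        (contDiffAt_snd.comp p (contDiffAt_snd.comp p (h1.comp p h2)))).contDiffWithinAt
    exact hcd.congr fun p hp ↦ (hsol p.1 hp.1 p.2 hp.2).2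

end LocalFlow

/-! ### Smooth local flows on a manifold. -/

section ManifoldFlow

/-- A function smooth near a point agrees near that point with a globally smooth function. -/
theorem ContDiffOn.exists_contDiff_eventuallyEq {E F : Type*} [NormedAddCommGroup E]
    [NormedSpace ℝ E] [FiniteDimensional ℝ E] [NormedAddCommGroup F] [NormedSpace ℝ F]
    {f : E → F} {U : Set E} (hf : ContDiffOn ℝ ∞ f U) (hU : IsOpen U) {x : E} (hx : x ∈ U) :
    ∃ f' : E → F, ContDiff ℝ ∞ f' ∧ f' =ᶠ[𝓝 x] f := by
  obtain ⟨r, hr, hrU⟩ := Metric.nhds_basis_closedBall.mem_iff.1 (hU.mem_nhds hx)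
  let ρ : ContDiffBump x := ⟨r / 2, r, by linarith, by linarith⟩
  refine ⟨fun y ↦ ρ y • f y, contDiff_iff_contDiffAt.2 fun y ↦ ?_, ?_⟩
  · by_cases hy : y ∈ Metric.closedBall x r
    · exact ρ.contDiff.contDiffAt.smul (hf.contDiffAt (hU.mem_nhds (hrU hy)))
    · refine (contDiffAt_const (c := (0 : F))).congr_of_eventuallyEq ?_
      filter_upwards [Metric.isClosed_closedBall.isOpen_compl.mem_nhds hy] with z hz
      rw [ρ.zero_of_le_dist (le_of_lt (not_le.1 hz)), zero_smul]
  · filter_upwards [ρ.eventuallyEq_one] with y hy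
    rw [hy, Pi.one_apply, one_smul]

variable {E : Type*} [NormedAddCommGroup E] [NormedSpace ℝ E]
  {M : Type*} [TopologicalSpace M] [ChartedSpace E M] [IsManifold 𝓘(ℝ, E) ∞ M]
  {v : (x : M) → TangentSpace 𝓘(ℝ, E) x}

/-- The coordinate expression of a vector field in the preferred chart at `q`. -/
noncomputable def chartField (v : (x : M) → TangentSpace 𝓘(ℝ, E) x) (q : M) (y : E) : E :=
  mfderiv 𝓘(ℝ, E) 𝓘(ℝ, E) (extChartAt 𝓘(ℝ, E) q) ((extChartAt 𝓘(ℝ, E) q).symm y)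
    (v ((extChartAt 𝓘(ℝ, E) q).symm y))

/-- The derivative of the chart is the fibre map of the tangent bundle trivialization at `q`, so
`chartField` is the section read in that trivialization. -/
theorem contDiffOn_chartField
    (hv : ContMDiff 𝓘(ℝ, E) 𝓘(ℝ, E).tangent ∞ (fun x ↦ (⟨x, v x⟩ : TangentBundle 𝓘(ℝ, E) M)))
    (q : M) : ContDiffOn ℝ ∞ (chartField v q) (extChartAt 𝓘(ℝ, E) q).target := by
  have h1 := ((trivializationAt E (TangentSpace 𝓘(ℝ, E)) q).contMDiffOn_section_baseSet_iff
    (IB := 𝓘(ℝ, E)) (n := ∞) (s := v)).1 hv.contMDiffOn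
  have h2 : ContMDiffOn 𝓘(ℝ, E) 𝓘(ℝ, E) ∞
      (fun x : M ↦ (mfderiv 𝓘(ℝ, E) 𝓘(ℝ, E) (extChartAt 𝓘(ℝ, E) q) x (v x) : E))
      (extChartAt 𝓘(ℝ, E) q).source := by
    rw [extChartAt_source]
    refine h1.congr fun x hx ↦ ?_
    have := TangentBundle.continuousLinearMapAt_trivializationAt (I := 𝓘(ℝ, E)) (𝕜 := ℝ) hx
    have h3 : (trivializationAt E (TangentSpace 𝓘(ℝ, E)) q).continuousLinearMapAt ℝ x (v x) =
        (trivializationAt E (TangentSpace 𝓘(ℝ, E)) q ⟨x, v x⟩).2 := by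
      rw [Trivialization.continuousLinearMapAt_apply, Trivialization.linearMapAt_apply,
        if_pos hx]
    exact (DFunLike.congr_fun this (v x)).symm.trans h3
  exact (h2.comp (contMDiffOn_extChartAt_symm q)
    (fun y hy ↦ (extChartAt 𝓘(ℝ, E) q).map_target hy)).contDiffOn

theorem hasMFDerivAt_extChartAt_symm_comp {q : M} {c : ℝ → E} {s : ℝ}
    (hs : c s ∈ (extChartAt 𝓘(ℝ, E) q).target) (hc : HasDerivAt c (chartField v q (c s)) s) :
    HasMFDerivAt 𝓘(ℝ, ℝ) 𝓘(ℝ, E) (fun s ↦ (extChartAt 𝓘(ℝ, E) q).symm (c s)) s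
      ((1 : ℝ →L[ℝ] ℝ).smulRight (v ((extChartAt 𝓘(ℝ, E) q).symm (c s)))) := by
  have h1 : MDifferentiableAt 𝓘(ℝ, E) 𝓘(ℝ, E) (extChartAt 𝓘(ℝ, E) q).symm (c s) :=
    ((contMDiffOn_extChartAt_symm (n := ∞) q).contMDiffAt
      ((isOpen_extChartAt_target q).mem_nhds hs)).mdifferentiableAt (by simp)
  have h2 := h1.hasMFDerivAt.comp s hc.hasFDerivAt.hasMFDerivAt
  refine h2.congr_mfderiv ?_
  have h3 := mfderivWithin_extChartAt_symm_comp_mfderiv_extChartAt (I := 𝓘(ℝ, E)) hs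
  rw [modelWithCornersSelf_coe, range_id, mfderivWithin_univ] at h3
  ext
  have h4 := DFunLike.congr_fun h3 (v ((extChartAt 𝓘(ℝ, E) q).symm (c s)))
  change mfderiv 𝓘(ℝ, E) 𝓘(ℝ, E) (extChartAt 𝓘(ℝ, E) q).symm (c s)
    ((1 : ℝ) • chartField v q (c s)) = (1 : ℝ) • v ((extChartAt 𝓘(ℝ, E) q).symm (c s))
  rw [one_smul, one_smul]
  exact h4

/-- A smooth vector field on a manifold has a smooth local flow near each point. -/
theorem exists_contMDiffOn_localFlow [FiniteDimensional ℝ E]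
    (hv : ContMDiff 𝓘(ℝ, E) 𝓘(ℝ, E).tangent ∞ (fun x ↦ (⟨x, v x⟩ : TangentBundle 𝓘(ℝ, E) M)))
    (q : M) : ∃ ε > 0, ∃ U : Set M, IsOpen U ∧ q ∈ U ∧ ∃ φ : ℝ × M → M,
      (∀ z ∈ U, φ (0, z) = z ∧ IsMIntegralCurveOn (fun s ↦ φ (s, z)) v (Ioo (-ε) ε)) ∧
      ContMDiffOn (𝓘(ℝ, ℝ).prod 𝓘(ℝ, E)) 𝓘(ℝ, E) ∞ φ (Ioo (-ε) ε ×ˢ U) := by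
  set e := extChartAt 𝓘(ℝ, E) q with he
  have heq : e q ∈ e.target := mem_extChartAt_target q
  -- The field in coordinates lives only on the chart target. It is replaced by a global field `f`
  -- equal to it near `e q`, and `ε` and `U` are then shrunk so that the flow of `f` stays in the
  -- region `B` where both agree.
  obtain ⟨f, hf, hfw⟩ := (contDiffOn_chartField hv q).exists_contDiff_eventuallyEq
    (isOpen_extChartAt_target q) heq
  obtain ⟨ε₁, hε₁, r, hr, α, hα, hαs⟩ := exists_contDiffOn_localFlow f hf (e q)
  obtain ⟨B, hB, hBo, hqB⟩ := mem_nhds_iff.1 (Filter.inter_mem hfw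
    ((isOpen_extChartAt_target q).mem_nhds heq))
  have hαc : ContinuousAt α (0, e q) := hαs.continuousOn.continuousAt
    (prod_mem_nhds (Ioo_mem_nhds (by linarith) hε₁) (Metric.ball_mem_nhds _ hr))
  have hα0 : α (0, e q) = e q := (hα _ (Metric.mem_ball_self hr)).1
  have hpre := hαc.preimage_mem_nhds (by rw [hα0]; exact hBo.mem_nhds hqB)
  obtain ⟨A, hA, C, hC, hAC⟩ := mem_nhds_prod_iff.1 hpre
  obtain ⟨ε₂, hε₂, hA'⟩ := Metric.mem_nhds_iff.1 hA
  obtain ⟨C', hC', hCo, hqC⟩ := mem_nhds_iff.1 (Filter.inter_mem hC (Metric.ball_mem_nhds _ hr))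
  let U : Set M := e.source ∩ e ⁻¹' C'
  have hUo : IsOpen U := (continuousOn_extChartAt q).isOpen_inter_preimage
    (isOpen_extChartAt_source q) hCo
  have hmem : ∀ s ∈ Ioo (-(min ε₁ ε₂)) (min ε₁ ε₂), ∀ z ∈ U, α (s, e z) ∈ B := by
    intro s hs z hz
    refine hAC ⟨hA' ?_, (hC' hz.2).1⟩
    rw [Metric.mem_ball, Real.dist_0_eq_abs]
    exact (abs_lt.2 hs).trans_le (min_le_right _ _)
  refine ⟨min ε₁ ε₂, lt_min hε₁ hε₂, U, hUo, ⟨mem_extChartAt_source q, hqC⟩,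
    fun p ↦ e.symm (α (p.1, e p.2)), fun z hz ↦ ⟨?_, fun s hs ↦ ?_⟩, ?_⟩
  · simp only [(hα _ (hC' hz.2).2).1]
    exact e.left_inv hz.1
  · have h1 := hmem s hs z hz
    have hs' : s ∈ Ioo (-ε₁) ε₁ := ⟨by linarith [hs.1, min_le_left ε₁ ε₂],
      by linarith [hs.2, min_le_left ε₁ ε₂]⟩
    have h2 := (hα _ (hC' hz.2).2).2 s hs'
    rw [show f (α (s, e z)) = chartField v q (α (s, e z)) from (hB h1).1] at h2
    exact (hasMFDerivAt_extChartAt_symm_comp (hB h1).2 h2).hasMFDerivWithinAt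
  · have h1 : ContMDiffOn 𝓘(ℝ, ℝ × E) 𝓘(ℝ, E) ∞ α (Ioo (-ε₁) ε₁ ×ˢ Metric.ball (e q) r) :=
      hαs.contMDiffOn
    have h2 : ContMDiffOn (𝓘(ℝ, ℝ).prod 𝓘(ℝ, E)) 𝓘(ℝ, ℝ × E) ∞ (fun p : ℝ × M ↦ (p.1, e p.2))
        (Ioo (-(min ε₁ ε₂)) (min ε₁ ε₂) ×ˢ U) := by
      refine contMDiffOn_fst.prodMk_space ?_
      refine (contMDiffOn_extChartAt (x := q)).comp contMDiffOn_snd ?_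
      intro p hp
      have := hp.2.1
      rwa [he, extChartAt_source] at this
    have h3 := h1.comp h2 (fun p hp ↦ ⟨⟨by linarith [hp.1.1, min_le_left ε₁ ε₂],
      by linarith [hp.1.2, min_le_left ε₁ ε₂]⟩, (hC' hp.2.2).2⟩)
    exact (contMDiffOn_extChartAt_symm (n := ∞) q).comp h3
      (fun p hp ↦ (hB (hmem p.1 hp.1 p.2 hp.2)).2)

end ManifoldFlow

/-! ### Maximal integral curves and global flows. -/

section MaximalCurves

variable {E : Type*} [NormedAddCommGroup E] [NormedSpace ℝ E]
  {M : Type*} [TopologicalSpace M] [ChartedSpace E M] [IsManifold 𝓘(ℝ, E) ∞ M] [T2Space M]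
  {v : (x : M) → TangentSpace 𝓘(ℝ, E) x}

theorem IsMIntegralCurveOn.eqOn_Ioo_inter
    (hv : ContMDiff 𝓘(ℝ, E) 𝓘(ℝ, E).tangent ∞ (fun x ↦ (⟨x, v x⟩ : TangentBundle 𝓘(ℝ, E) M)))
    {γ γ' : ℝ → M} {a b a' b' t : ℝ} (ht : t ∈ Ioo a b) (ht' : t ∈ Ioo a' b')
    (hγ : IsMIntegralCurveOn γ v (Ioo a b)) (hγ' : IsMIntegralCurveOn γ' v (Ioo a' b'))
    (h : γ t = γ' t) {s : ℝ} (hs : s ∈ Ioo a b) (hs' : s ∈ Ioo a' b') : γ s = γ' s :=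
  isMIntegralCurveOn_Ioo_eqOn_of_contMDiff_boundaryless (a := max a a') (b := min b b')
    ⟨max_lt ht.1 ht'.1, lt_min ht.2 ht'.2⟩ (hv.of_le (by simp))
    (hγ.mono (Ioo_subset_Ioo (le_max_left _ _) (min_le_left _ _)))
    (hγ'.mono (Ioo_subset_Ioo (le_max_right _ _) (min_le_right _ _))) h
    ⟨max_lt hs.1 hs'.1, lt_min hs.2 hs'.2⟩

variable [FiniteDimensional ℝ E]

/-- `(a, b)` is a time interval around `0` carrying an integral curve `γ` of `v` through `p`. -/
structure IsLocalSolution (v : (x : M) → TangentSpace 𝓘(ℝ, E) x) (p : M) (a b : ℝ) (γ : ℝ → M) :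
    Prop where
  neg : a < 0
  pos : 0 < b
  init : γ 0 = p
  curve : IsMIntegralCurveOn γ v (Ioo a b)

/-- The maximal integral curves of a smooth vector field: local solutions glue. -/
theorem exists_maximal_solution
    (hv : ContMDiff 𝓘(ℝ, E) 𝓘(ℝ, E).tangent ∞ (fun x ↦ (⟨x, v x⟩ : TangentBundle 𝓘(ℝ, E) M)))
    (p : M) : ∃ (I : Set ℝ) (γ : ℝ → M), IsOpen I ∧ I.OrdConnected ∧ (0 : ℝ) ∈ I ∧ γ 0 = p ∧
      (∀ s ∈ I, ∃ a b, IsLocalSolution v p a b γ ∧ s ∈ Ioo a b) ∧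
      ∀ a b γ', IsLocalSolution v p a b γ' → Ioo a b ⊆ I ∧ EqOn γ γ' (Ioo a b) := by
  classical
  let I : Set ℝ := {s | ∃ a b γ', IsLocalSolution v p a b γ' ∧ s ∈ Ioo a b}
  have hsub : ∀ a b γ', IsLocalSolution v p a b γ' → Ioo a b ⊆ I :=
    fun a b γ' h s hs ↦ ⟨a, b, γ', h, hs⟩
  have : Nonempty M := ⟨p⟩
  choose! A B Γ hΓ hAB using fun s (hs : s ∈ I) ↦ hs
  -- Each time uses its own local solution; by uniqueness this diagonal choice agrees with every
  -- local solution.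
  let γ : ℝ → M := fun s ↦ Γ s s
  have hγ : ∀ a b γ', IsLocalSolution v p a b γ' → EqOn γ γ' (Ioo a b) := by
    intro a b γ' h s hs
    have hsI : s ∈ I := hsub a b γ' h hs
    exact (hΓ s hsI).curve.eqOn_Ioo_inter hv ⟨(hΓ s hsI).neg, (hΓ s hsI).pos⟩ ⟨h.neg, h.pos⟩
      h.curve ((hΓ s hsI).init.trans h.init.symm) (hAB s hsI) hs
  have hloc : ∀ a b γ', IsLocalSolution v p a b γ' → IsLocalSolution v p a b γ := by
    intro a b γ' h
    refine ⟨h.neg, h.pos, (hγ a b γ' h ⟨h.neg, h.pos⟩).trans h.init, fun s hs ↦ ?_⟩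
    have := (h.curve s hs).congr_of_eventuallyEq
      (Filter.eventuallyEq_of_mem self_mem_nhdsWithin (hγ a b γ' h)) (hγ a b γ' h hs)
    rwa [hγ a b γ' h hs]
  obtain ⟨γ₀, h₀, hc₀⟩ := exists_isMIntegralCurveAt_of_contMDiffAt_boundaryless (t₀ := 0)
    ((hv.of_le (m := 1) (by simp)).contMDiffAt (x := p))
  obtain ⟨ε, hε, hcε⟩ := isMIntegralCurveAt_iff'.1 hc₀
  rw [Real.ball_eq_Ioo, zero_sub, zero_add] at hcε
  have hsol₀ : IsLocalSolution v p (-ε) ε γ₀ := ⟨by linarith, hε, h₀, hcε⟩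
  refine ⟨I, γ, ?_, ⟨?_⟩, hsub _ _ _ hsol₀ ⟨hsol₀.neg, hsol₀.pos⟩, (hloc _ _ _ hsol₀).init, ?_,
    fun a b γ' h ↦ ⟨hsub a b γ' h, hγ a b γ' h⟩⟩
  · refine isOpen_iff_mem_nhds.2 fun s hs ↦ ?_
    exact Filter.mem_of_superset (Ioo_mem_nhds (hAB s hs).1 (hAB s hs).2)
      (hsub _ _ _ (hΓ s hs))
  · intro s₁ h₁ s₂ h₂ s hs
    rcases le_total 0 s with h | h
    · exact hsub _ _ _ (hΓ s₂ h₂) ⟨(hΓ s₂ h₂).neg.trans_le h, hs.2.trans_lt (hAB s₂ h₂).2⟩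
    · exact hsub _ _ _ (hΓ s₁ h₁) ⟨(hAB s₁ h₁).1.trans_le hs.1, h.trans_lt (hΓ s₁ h₁).pos⟩
  · exact fun s hs ↦ ⟨_, _, hloc _ _ _ (hΓ s hs), hAB s hs⟩

omit [FiniteDimensional ℝ E] in
/-- An integral curve, defined on `Ioo a b` and passing through the domain of a local flow,
can be continued along the local flow. -/
theorem IsLocalSolution.extend
    (hv : ContMDiff 𝓘(ℝ, E) 𝓘(ℝ, E).tangent ∞ (fun x ↦ (⟨x, v x⟩ : TangentBundle 𝓘(ℝ, E) M)))
    {p : M} {a b ε s : ℝ} {γ β : ℝ → M} (h : IsLocalSolution v p a b γ) (hε : 0 < ε)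
    (hs : s ∈ Ioo a b) (h0 : β 0 = γ s) (hβ : IsMIntegralCurveOn β v (Ioo (-ε) ε)) :
    ∃ γ', IsLocalSolution v p (min a (s - ε)) (max b (s + ε)) γ' ∧
      ∀ δ ∈ Ioo (-ε) ε, γ' (s + δ) = β δ := by
  classical
  have hβ' : IsMIntegralCurveOn (β ∘ (· - s)) v (Ioo (s - ε) (s + ε)) := by
    refine ((isMIntegralCurveOn_comp_sub (dt := s)).2 hβ).mono fun r hr ↦ ?_
    exact ⟨by linarith [hr.1], by linarith [hr.2]⟩
  have hmem : s ∈ Ioo a b ∩ Ioo (s - ε) (s + ε) := ⟨hs, by linarith, by linarith⟩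
  have heq : γ s = (β ∘ (· - s)) s := by simp [h0]
  have hv1 := hv.of_le (m := 1) (by simp)
  have hP := isMIntegralCurveOn_piecewise hv1 h.curve hβ' hmem heq
  refine ⟨piecewise (Ioo a b) γ (β ∘ (· - s)), ⟨lt_of_le_of_lt (min_le_left _ _) h.neg,
    h.pos.trans_le (le_max_left _ _), ?_, hP.mono ?_⟩, fun δ hδ ↦ ?_⟩
  · exact (piecewise_eq_of_mem (Ioo a b) _ _ ⟨h.neg, h.pos⟩).trans h.init
  · rw [Ioo_union_Ioo' (by linarith [hs.2]) (by linarith [hs.1])]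
  · have hsδ : s + δ ∈ Ioo (s - ε) (s + ε) := ⟨by linarith [hδ.1], by linarith [hδ.2]⟩
    rw [eqOn_piecewise_of_isMIntegralCurveOn_Ioo hv1 h.curve hβ' hmem heq hsδ]
    simp

/-- **Maximal integral curves** of a nowhere vanishing smooth vector field are smooth and have no
endpoints. -/
theorem exists_inextendible_integralCurve
    (hv : ContMDiff 𝓘(ℝ, E) 𝓘(ℝ, E).tangent ∞ (fun x ↦ (⟨x, v x⟩ : TangentBundle 𝓘(ℝ, E) M)))
    (hv0 : ∀ x, v x ≠ 0) (p : M) :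
    ∃ (I : Set ℝ) (γ : ℝ → M), IsOpen I ∧ I.OrdConnected ∧ (0 : ℝ) ∈ I ∧ γ 0 = p ∧
      (∀ s ∈ I, HasMFDerivAt 𝓘(ℝ, ℝ) 𝓘(ℝ, E) γ s ((1 : ℝ →L[ℝ] ℝ).smulRight (v (γ s)))) ∧
      (∀ s ∈ I, ContMDiffAt 𝓘(ℝ, ℝ) 𝓘(ℝ, E) ∞ γ s) ∧
      (∀ q : M, ¬ ∀ U ∈ 𝓝 q, ∃ s₀ ∈ I, ∀ s ∈ I, s₀ ≤ s → γ s ∈ U) ∧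
      (∀ q : M, ¬ ∀ U ∈ 𝓝 q, ∃ s₀ ∈ I, ∀ s ∈ I, s ≤ s₀ → γ s ∈ U) := by
  obtain ⟨I, γ, hIo, hIc, h0I, hγ0, hsol, hmax⟩ := exists_maximal_solution hv p
  have hderiv : ∀ s ∈ I,
      HasMFDerivAt 𝓘(ℝ, ℝ) 𝓘(ℝ, E) γ s ((1 : ℝ →L[ℝ] ℝ).smulRight (v (γ s))) := by
    intro s hs
    obtain ⟨a, b, h, hab⟩ := hsol s hs
    exact (h.curve s hab).hasMFDerivAt (Ioo_mem_nhds hab.1 hab.2)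
  have hext : ∀ {ε : ℝ} {β : ℝ → M} {s : ℝ}, 0 < ε → s ∈ I → β 0 = γ s →
      IsMIntegralCurveOn β v (Ioo (-ε) ε) → ∀ δ ∈ Ioo (-ε) ε, s + δ ∈ I ∧ γ (s + δ) = β δ := by
    intro ε β s hε hs h0 hβ δ hδ
    obtain ⟨a, b, h, hab⟩ := hsol s hs
    obtain ⟨γ', h', hγ'⟩ := h.extend hv hε hab h0 hβ
    have hmem : s + δ ∈ Ioo (min a (s - ε)) (max b (s + ε)) :=
      ⟨(min_le_right _ _).trans_lt (by linarith [hδ.1]),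
        lt_of_lt_of_le (by linarith [hδ.2]) (le_max_right _ _)⟩
    exact ⟨(hmax _ _ _ h').1 hmem, ((hmax _ _ _ h').2 hmem).trans (hγ' δ hδ)⟩
  -- If `γ` tends to `q` along a translation invariant filter, then `γ (s + δ)` has the same limit
  -- `q`, so the local flow fixes `q` and `v` vanishes there. The filters meant are `atTop` and
  -- `atBot`.
  have hcore : ∀ (q : M) (l : Filter ℝ) [l.NeBot], (∀ δ, Tendsto (fun s ↦ s + δ) l l) →
      (∀ᶠ s in l, s ∈ I) → ¬ Tendsto γ l (𝓝 q) := by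
    intro q l _ hl hlI hlim
    obtain ⟨ε, hε, U, hUo, hqU, φ, hφ, hφs⟩ := exists_contMDiffOn_localFlow hv q
    have hfix : ∀ δ ∈ Ioo (-ε) ε, φ (δ, q) = q := by
      intro δ hδ
      have hc : ContinuousAt φ (δ, q) := hφs.continuousOn.continuousAt
        ((isOpen_Ioo.prod hUo).mem_nhds ⟨hδ, hqU⟩)
      have h1 : Tendsto (fun s ↦ φ (δ, γ s)) l (𝓝 (φ (δ, q))) :=
        hc.tendsto.comp (tendsto_const_nhds.prodMk_nhds hlim)
      refine tendsto_nhds_unique (h1.congr' ?_) (hlim.comp (hl δ))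
      filter_upwards [hlI, hlim (hUo.mem_nhds hqU)] with s hs hsU
      exact ((hext hε hs (hφ _ hsU).1 (hφ _ hsU).2 δ hδ).2).symm
    have h0 : (0 : ℝ) ∈ Ioo (-ε) ε := ⟨by linarith, hε⟩
    have h1 : HasMFDerivAt 𝓘(ℝ, ℝ) 𝓘(ℝ, E) (fun s ↦ φ (s, q)) 0
        ((1 : ℝ →L[ℝ] ℝ).smulRight (v (φ (0, q)))) :=
      ((hφ q hqU).2 0 h0).hasMFDerivAt (Ioo_mem_nhds h0.1 h0.2)
    have h2 : HasMFDerivAt 𝓘(ℝ, ℝ) 𝓘(ℝ, E) (fun _ : ℝ ↦ q) 0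
        (0 : TangentSpace 𝓘(ℝ, ℝ) (0 : ℝ) →L[ℝ] TangentSpace 𝓘(ℝ, E) q) :=
      hasMFDerivAt_const q 0
    have h3 := h2.congr_of_eventuallyEq (f₁ := fun s ↦ φ (s, q))
      (by filter_upwards [Ioo_mem_nhds h0.1 h0.2] with s hs using hfix s hs)
    have h4 := hasMFDerivAt_unique h1 h3
    refine hv0 (φ (0, q)) ?_
    have h5 := DFunLike.congr_fun h4 (1 : ℝ)
    change (1 : ℝ) • v (φ (0, q)) = 0 at h5
    rwa [one_smul] at h5
  refine ⟨I, γ, hIo, hIc, h0I, hγ0, hderiv, ?_, ?_, ?_⟩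
  · intro s hs
    obtain ⟨ε, hε, U, hUo, hqU, φ, hφ, hφs⟩ := exists_contMDiffOn_localFlow hv (γ s)
    have h1 : ContMDiffAt (𝓘(ℝ, ℝ).prod 𝓘(ℝ, E)) 𝓘(ℝ, E) ∞ φ (s - s, γ s) :=
      hφs.contMDiffAt ((isOpen_Ioo.prod hUo).mem_nhds ⟨by simp [hε], hqU⟩)
    have h2 : ContMDiffAt 𝓘(ℝ, ℝ) (𝓘(ℝ, ℝ).prod 𝓘(ℝ, E)) ∞
        (fun r : ℝ ↦ (r - s, γ s)) s :=
      (ContDiff.contMDiff (by fun_prop)).contMDiffAt.prodMk contMDiffAt_const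
    refine (h1.comp (f := fun r : ℝ ↦ (r - s, γ s)) s h2).congr_of_eventuallyEq ?_
    filter_upwards [Ioo_mem_nhds (show s - ε < s by linarith) (show s < s + ε by linarith)]
      with r hr
    have := (hext hε hs (hφ _ hqU).1 (hφ _ hqU).2 (r - s)
      ⟨by linarith [hr.1], by linarith [hr.2]⟩).2
    simpa using this
  · intro q hq
    -- All solutions starting near `q` live for a common time `ε`; one starting within `ε / 2` of
    -- `sSup I` would continue beyond `I`.
    have hunb : ¬ BddAbove I := by
      intro hb
      obtain ⟨ε, hε, U, hUo, hqU, φ, hφ, hφs⟩ := exists_contMDiffOn_localFlow hv q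
      obtain ⟨s₀, hs₀, hU⟩ := hq U (hUo.mem_nhds hqU)
      obtain ⟨s₁, hs₁, hlt⟩ := exists_lt_of_lt_csSup ⟨0, h0I⟩
        (show sSup I - ε / 2 < sSup I by linarith)
      have hmax' : max s₀ s₁ ∈ I := by rcases max_choice s₀ s₁ with h | h <;> rwa [h]
      have hz := hφ _ (hU _ hmax' (le_max_left _ _))
      have := (hext hε hmax' hz.1 hz.2 (ε / 2) ⟨by linarith, by linarith⟩).1
      linarith [le_csSup hb this, le_max_right s₀ s₁]
    refine hcore q atTop (fun δ ↦ tendsto_atTop_add_const_right _ _ tendsto_id) ?_ ?_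
    · filter_upwards [eventually_ge_atTop 0] with s hs
      obtain ⟨s', hs', hlt⟩ := not_bddAbove_iff.1 hunb s
      exact hIc.out h0I hs' ⟨hs, hlt.le⟩
    · intro U hU
      obtain ⟨s₀, hs₀, h⟩ := hq U hU
      change ∀ᶠ s in atTop, γ s ∈ U
      filter_upwards [eventually_ge_atTop s₀] with s hs
      obtain ⟨s', hs', hlt⟩ := not_bddAbove_iff.1 hunb s
      exact h s (hIc.out hs₀ hs' ⟨hs, hlt.le⟩) hs
  · intro q hq
    have hunb : ¬ BddBelow I := by
      intro hb
      obtain ⟨ε, hε, U, hUo, hqU, φ, hφ, hφs⟩ := exists_contMDiffOn_localFlow hv q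
      obtain ⟨s₀, hs₀, hU⟩ := hq U (hUo.mem_nhds hqU)
      obtain ⟨s₁, hs₁, hlt⟩ := exists_lt_of_csInf_lt ⟨0, h0I⟩
        (show sInf I < sInf I + ε / 2 by linarith)
      have hmin' : min s₀ s₁ ∈ I := by rcases min_choice s₀ s₁ with h | h <;> rwa [h]
      have hz := hφ _ (hU _ hmin' (min_le_left _ _))
      have := (hext hε hmin' hz.1 hz.2 (-(ε / 2)) ⟨by linarith, by linarith⟩).1
      linarith [csInf_le hb this, min_le_right s₀ s₁]
    refine hcore q atBot (fun δ ↦ tendsto_atBot_add_const_right _ _ tendsto_id) ?_ ?_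
    · filter_upwards [eventually_le_atBot 0] with s hs
      obtain ⟨s', hs', hlt⟩ := not_bddBelow_iff.1 hunb s
      exact hIc.out hs' h0I ⟨hlt.le, hs⟩
    · intro U hU
      obtain ⟨s₀, hs₀, h⟩ := hq U hU
      change ∀ᶠ s in atBot, γ s ∈ U
      filter_upwards [eventually_le_atBot s₀] with s hs
      obtain ⟨s', hs', hlt⟩ := not_bddBelow_iff.1 hunb s
      exact h s (hIc.out hs' hs₀ ⟨hlt.le, hs⟩) hs

/-- A complete smooth vector field has a smooth global flow. -/
theorem exists_contMDiff_flow
    (hv : ContMDiff 𝓘(ℝ, E) 𝓘(ℝ, E).tangent ∞ (fun x ↦ (⟨x, v x⟩ : TangentBundle 𝓘(ℝ, E) M)))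
    (hcomplete : ∀ p, ∃ γ : ℝ → M, γ 0 = p ∧ IsMIntegralCurve γ v) :
    ∃ Φ : ℝ × M → M, ContMDiff (𝓘(ℝ, ℝ).prod 𝓘(ℝ, E)) 𝓘(ℝ, E) ∞ Φ ∧
      (∀ p, Φ (0, p) = p) ∧ (∀ p, IsMIntegralCurve (fun s ↦ Φ (s, p)) v) ∧
      ∀ s t p, Φ (s + t, p) = Φ (s, Φ (t, p)) := by
  choose Γ hΓ0 hΓ using hcomplete
  have hv1 := hv.of_le (m := 1) (by simp)
  let Φ : ℝ × M → M := fun w ↦ Γ w.2 w.1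
  have hadd : ∀ s t p, Φ (s + t, p) = Φ (s, Φ (t, p)) := by
    intro s t p
    have := isMIntegralCurve_Ioo_eq_of_contMDiff_boundaryless (t₀ := 0) hv1
      ((hΓ p).comp_add t) (hΓ (Φ (t, p))) (by simp [Φ, hΓ0])
    exact congr_fun this s
  have hlocal : ∀ q : M, ∃ ε > 0, ∃ U : Set M, IsOpen U ∧ q ∈ U ∧ ∀ δ ∈ Ioo (-ε) ε, ∀ z ∈ U,
      ContMDiffAt (𝓘(ℝ, ℝ).prod 𝓘(ℝ, E)) 𝓘(ℝ, E) ∞ Φ (δ, z) := by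
    intro q
    obtain ⟨ε, hε, U, hUo, hqU, φ, hφ, hφs⟩ := exists_contMDiffOn_localFlow hv q
    refine ⟨ε, hε, U, hUo, hqU, fun δ hδ z hz ↦ ?_⟩
    have hnhds := (isOpen_Ioo.prod hUo).mem_nhds (show (δ, z) ∈ Ioo (-ε) ε ×ˢ U from ⟨hδ, hz⟩)
    refine (hφs.contMDiffAt hnhds).congr_of_eventuallyEq ?_
    filter_upwards [hnhds] with w hw
    exact isMIntegralCurveOn_Ioo_eqOn_of_contMDiff_boundaryless (t₀ := 0)
      ⟨by linarith, hε⟩ hv1 ((hΓ w.2).isMIntegralCurveOn _) (hφ w.2 hw.2).2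
      ((hΓ0 w.2).trans (hφ w.2 hw.2).1.symm) hw.1
  have hstep : ∀ δ s p, ContMDiffAt (𝓘(ℝ, ℝ).prod 𝓘(ℝ, E)) 𝓘(ℝ, E) ∞ Φ (δ, Φ (s, p)) →
      ContMDiffAt (𝓘(ℝ, ℝ).prod 𝓘(ℝ, E)) 𝓘(ℝ, E) ∞ Φ (s, p) →
      ContMDiffAt (𝓘(ℝ, ℝ).prod 𝓘(ℝ, E)) 𝓘(ℝ, E) ∞ Φ (δ + s, p) := by
    intro δ s p h1 h2
    have h3 : ContMDiffAt (𝓘(ℝ, ℝ).prod 𝓘(ℝ, E)) (𝓘(ℝ, ℝ).prod 𝓘(ℝ, E)) ∞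
        (fun w : ℝ × M ↦ (w.1 - δ, w.2)) (δ + s, p) :=
      ((ContDiff.contMDiff (f := fun r : ℝ ↦ r - δ) (by fun_prop)).contMDiffAt.comp _
        contMDiffAt_fst).prodMk contMDiffAt_snd
    have h4 : ContMDiffAt (𝓘(ℝ, ℝ).prod 𝓘(ℝ, E)) 𝓘(ℝ, E) ∞
        (fun w : ℝ × M ↦ Φ (w.1 - δ, w.2)) (δ + s, p) :=
      ContMDiffAt.comp (g := Φ) (f := fun w : ℝ × M ↦ (w.1 - δ, w.2)) (δ + s, p)
        (by simpa using h2) h3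
    have h5 : ContMDiffAt (𝓘(ℝ, ℝ).prod 𝓘(ℝ, E)) 𝓘(ℝ, E) ∞
        (fun w : ℝ × M ↦ Φ (δ, Φ (w.1 - δ, w.2))) (δ + s, p) :=
      ContMDiffAt.comp (g := Φ) (f := fun w : ℝ × M ↦ (δ, Φ (w.1 - δ, w.2))) (δ + s, p)
        (by simpa using h1) (contMDiffAt_const.prodMk h4)
    refine h5.congr_of_eventuallyEq (Eventually.of_forall fun w ↦ ?_)
    change Φ (w.1, w.2) = Φ (δ, Φ (w.1 - δ, w.2))
    rw [← hadd, add_sub_cancel]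
  refine ⟨Φ, ?_, hΓ0, hΓ, hadd⟩
  rintro ⟨s, p⟩
  -- `A` is clopen: near a limit point `s₀`, the group law writes the flow as a short-time flow near
  -- `Φ (s₀, p)` after the flow up to some `s₁ ∈ A`.
  let A : Set ℝ := {s | ContMDiffAt (𝓘(ℝ, ℝ).prod 𝓘(ℝ, E)) 𝓘(ℝ, E) ∞ Φ (s, p)}
  have hcl : closure A ⊆ interior A := by
    intro s₀ hs₀
    obtain ⟨ε, hε, U, hUo, hqU, hsm⟩ := hlocal (Φ (s₀, p))
    have hcont : Continuous fun s ↦ Φ (s, p) := (hΓ p).continuous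
    have hnear : ∀ᶠ s in 𝓝 s₀, Φ (s, p) ∈ U ∧ s ∈ Ioo (s₀ - ε / 2) (s₀ + ε / 2) :=
      (hcont.continuousAt.eventually (hUo.mem_nhds hqU)).and
        (Ioo_mem_nhds (by linarith) (by linarith))
    obtain ⟨s₁, hs₁A, hs₁U, hs₁⟩ :=
      ((mem_closure_iff_frequently.1 hs₀).and_eventually hnear).exists
    refine mem_interior_iff_mem_nhds.2 ?_
    filter_upwards [Ioo_mem_nhds (show s₀ - ε / 2 < s₀ by linarith)
      (show s₀ < s₀ + ε / 2 by linarith)] with s hs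
    have := hstep (s - s₁) s₁ p (hsm (s - s₁) ⟨by linarith [hs.1, hs₁.2], by
      linarith [hs.2, hs₁.1]⟩ _ hs₁U) hs₁A
    rwa [sub_add_cancel] at this
  have hclopen : IsClopen A :=
    ⟨closure_subset_iff_isClosed.1 (hcl.trans interior_subset),
      subset_interior_iff_isOpen.1 (subset_closure.trans hcl)⟩
  have h0 : (0 : ℝ) ∈ A := by
    obtain ⟨ε, hε, U, hUo, hqU, hsm⟩ := hlocal p
    exact hsm 0 ⟨by linarith, hε⟩ p hqU
  have : A = univ := hclopen.eq_univ ⟨0, h0⟩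
  exact this.ge (mem_univ s)

end MaximalCurves

/-! ### Linear algebra of Lorentzian forms. -/

section LorentzAlgebra

variable {V : Type*} [AddCommGroup V] [Module ℝ V] [TopologicalSpace V]
  {B : V →L[ℝ] V →L[ℝ] ℝ}

/-- In a form of signature `(-, +, ..., +)` the orthogonal complement of any negative vector is
positive definite. -/
theorem lorentz_pos_of_orthogonal (hs : ∀ v w, B v w = B w v)
    (hB : ∃ v, B v v < 0 ∧ ∀ w, B v w = 0 → w ≠ 0 → 0 < B w w) {u w : V} (hu : B u u < 0)
    (huw : B u w = 0) (hw : w ≠ 0) : 0 < B w w := by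
  obtain ⟨v, hv, hpos⟩ := hB
  by_contra hneg
  rw [not_lt] at hneg
  have hwu : B w u = 0 := by rw [hs, huw]
  -- This combination is orthogonal to the reference vector `v`, so it is zero or has positive
  -- square; if `B w w ≤ 0`, its square is `(B v w)² B u u + (B v u)² B w w ≤ 0`.
  by_cases hz : B v w • u - B v u • w = 0
  · have h1 : B u (B v w • u - B v u • w) = 0 := by rw [hz, map_zero]
    simp only [map_sub, map_smul, smul_eq_mul, huw, mul_zero, sub_zero] at h1
    have h2 : B v w = 0 := (mul_eq_zero.1 h1).resolve_right hu.ne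
    rw [h2, zero_smul, zero_sub, neg_eq_zero, smul_eq_zero] at hz
    have h3 : B v u = 0 := hz.resolve_right hw
    have hu0 : u ≠ 0 := by rintro rfl; simp at hu
    exact lt_asymm hu (hpos u h3 hu0)
  · have h1 := hpos _ (by simp only [map_sub, map_smul, smul_eq_mul]; ring) hz
    simp only [map_sub, map_smul, sub_apply, smul_apply, smul_eq_mul, huw, hwu] at h1
    nlinarith [mul_nonneg (sq_nonneg (B v w)) (neg_nonneg.2 hu.le),
      mul_nonneg (sq_nonneg (B v u)) (neg_nonneg.2 hneg)]

/-- The combination `B w X • v - B v X • w` is orthogonal to the timelike `X`, so it cannot have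
negative square; `B v w ≥ 0` would force exactly that, or a contradiction upon pairing with `v` when
the combination vanishes. Convexity of the time cone follows. -/
theorem lorentz_neg_of_same_cone (hs : ∀ v w, B v w = B w v)
    (hB : ∃ v, B v v < 0 ∧ ∀ w, B v w = 0 → w ≠ 0 → 0 < B w w) {X v w : V} (hX : B X X < 0)
    (hv : B v v < 0) (hw : B w w < 0) (hvX : 0 < B v X) (hwX : 0 < B w X) : B v w < 0 := by
  by_contra hneg
  rw [not_lt] at hneg
  by_cases hz : B w X • v - B v X • w = 0
  · have h1 : B v (B w X • v - B v X • w) = 0 := by rw [hz, map_zero]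
    simp only [map_sub, map_smul, smul_eq_mul] at h1
    nlinarith [mul_pos hwX (neg_pos.2 hv), mul_nonneg hvX.le hneg]
  · have h1 := lorentz_pos_of_orthogonal hs hB hX
      (by simp only [map_sub, map_smul, smul_eq_mul]; rw [hs X v, hs X w]; ring) hz
    simp only [map_sub, map_smul, sub_apply, smul_apply, smul_eq_mul, hs w v] at h1
    nlinarith [mul_pos (mul_pos hwX hwX) (neg_pos.2 hv),
      mul_pos (mul_pos hvX hvX) (neg_pos.2 hw), mul_nonneg (mul_pos hwX hvX).le hneg]

theorem lorentz_add_neg (hs : ∀ v w, B v w = B w v)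
    (hB : ∃ v, B v v < 0 ∧ ∀ w, B v w = 0 → w ≠ 0 → 0 < B w w) {X v w : V} (hX : B X X < 0)
    (hv : B v v < 0) (hw : B w w < 0) (hvX : 0 < B v X) (hwX : 0 < B w X) :
    B (v + w) (v + w) < 0 ∧ 0 < B (v + w) X := by
  have := lorentz_neg_of_same_cone hs hB hX hv hw hvX hwX
  simp only [map_add, add_apply, hs w v]
  constructor <;> linarith

/-- A form of signature `(-, +, ..., +)` on a finite-dimensional space is invertible. -/
theorem lorentz_isInvertible {V : Type*} [NormedAddCommGroup V] [NormedSpace ℝ V]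
    [FiniteDimensional ℝ V] {B : V →L[ℝ] V →L[ℝ] ℝ} (hB : ∀ v, (∀ w, B v w = 0) → v = 0) :
    B.IsInvertible := by
  have hinj : Function.Injective B.toLinearMap := by
    rw [injective_iff_map_eq_zero]
    exact fun v hv ↦ hB v fun w ↦ DFunLike.congr_fun hv w
  have hdim : Module.finrank ℝ V = Module.finrank ℝ (V →L[ℝ] ℝ) := by
    rw [← (LinearMap.toContinuousLinearMap (𝕜 := ℝ) (E := V) (F' := ℝ)).finrank_eq]
    exact (Subspace.dual_finrank_eq (K := ℝ) (V := V)).symm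
  exact ⟨(LinearEquiv.ofInjectiveOfFinrankEq B.toLinearMap hinj hdim).toContinuousLinearEquiv,
    by ext; rfl⟩

end LorentzAlgebra

/-! ### Smoothness of tensor fields and of gradients. -/

section TensorSmoothness

variable {E : Type*} [NormedAddCommGroup E] [NormedSpace ℝ E]
  {H : Type*} [TopologicalSpace H] {I : ModelWithCorners ℝ E H}
  {M : Type*} [TopologicalSpace M] [ChartedSpace H M]

theorem contMDiffAt_clm_of_apply [FiniteDimensional ℝ E] {F : Type*} [NormedAddCommGroup F]
    [NormedSpace ℝ F] {L : M → E →L[ℝ] F} {x₀ : M}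
    (h : ∀ u, ContMDiffAt I 𝓘(ℝ, F) ∞ (fun x ↦ L x u) x₀) :
    ContMDiffAt I 𝓘(ℝ, E →L[ℝ] F) ∞ L x₀ := by
  let e₁ : E ≃L[ℝ] (Fin (Module.finrank ℝ E) → ℝ) :=
    ContinuousLinearEquiv.ofFinrankEq (Module.finrank_fin_fun ℝ).symm
  let e₂ := (e₁.arrowCongr (1 : F ≃L[ℝ] F)).trans
    (ContinuousLinearEquiv.piRing (Fin (Module.finrank ℝ E)))
  have h1 : ContMDiffAt I 𝓘(ℝ, Fin (Module.finrank ℝ E) → F) ∞ (fun x ↦ e₂ (L x)) x₀ :=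
    contMDiffAt_pi_space.2 fun i ↦ h _
  have h2 := e₂.symm.contDiff.contMDiff.contMDiffAt.comp x₀ h1 (n := ∞)
  refine h2.congr_of_eventuallyEq (Eventually.of_forall fun x ↦ ?_)
  simp

variable [IsManifold I ∞ M]

variable (I) in
/-- The vector field near `x₀` with constant coordinates `u`. -/
noncomputable def constField (x₀ : M) (u : E) (x : M) :
    TangentSpace I x :=
  (trivializationAt E (TangentSpace I : M → Type _) x₀).symm x u

theorem contMDiffAt_constField (x₀ : M) (u : E) :
    ContMDiffAt I I.tangent ∞ (fun x ↦ (⟨x, constField I x₀ u x⟩ : TangentBundle I M)) x₀ := by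
  have hx₀ := FiberBundle.mem_baseSet_trivializationAt' (F := E) (E := (TangentSpace I : M → Type _)) x₀
  refine ((trivializationAt E (TangentSpace I) x₀).contMDiffAt_section_iff hx₀).2 ?_
  refine (contMDiffAt_const (c := u)).congr_of_eventuallyEq ?_
  filter_upwards [(trivializationAt E (TangentSpace I) x₀).open_baseSet.mem_nhds hx₀] with x hx
  unfold constField
  exact congr_arg Prod.snd
    ((trivializationAt E (TangentSpace I) x₀).apply_mk_symm hx u)

theorem inCoordinates_bilin_apply {x₀ x : M} {u w : E}
    (B : TangentSpace I x →L[ℝ] TangentSpace I x →L[ℝ] ℝ)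
    (hx : x ∈ (trivializationAt E (TangentSpace I) x₀).baseSet) :
    ContinuousLinearMap.inCoordinates E (TangentSpace I) (E →L[ℝ] ℝ)
      (fun x : M ↦ TangentSpace I x →L[ℝ] ℝ) x₀ x x₀ x B u w =
        B (constField I x₀ u x) (constField I x₀ w x) := by
  have h := inCoordinates_apply_eq₂ (E₁ := (TangentSpace I : M → Type _))
    (E₂ := (TangentSpace I : M → Type _)) (F₃ := ℝ) (E₃ := Bundle.Trivial M ℝ) (ϕ := B)
    (v := u) (w := w) hx hx (by simp : x ∈ (trivializationAt ℝ (Bundle.Trivial M ℝ) x₀).baseSet)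
  refine h.trans ?_
  simp only [Bundle.Trivial.fiberBundle_trivializationAt',
    Bundle.Trivial.linearMapAt_trivialization]
  rfl

/-- A field of bilinear forms is smooth if it is smooth on vector fields with constant
coordinates. -/
theorem contMDiffAt_bilin_of_constField [FiniteDimensional ℝ E]
    {B : ∀ x : M, TangentSpace I x →L[ℝ] TangentSpace I x →L[ℝ] ℝ} {x₀ : M}
    (h : ∀ u w, ContMDiffAt I 𝓘(ℝ, ℝ) ∞
      (fun x ↦ B x (constField I x₀ u x) (constField I x₀ w x)) x₀) :
    ContMDiffAt I (I.prod 𝓘(ℝ, E →L[ℝ] E →L[ℝ] ℝ)) ∞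
      (fun x ↦ TotalSpace.mk' (E →L[ℝ] E →L[ℝ] ℝ) x (B x)) x₀ := by
  rw [contMDiffAt_hom_bundle]
  refine ⟨contMDiffAt_id, contMDiffAt_clm_of_apply fun u ↦ contMDiffAt_clm_of_apply fun w ↦ ?_⟩
  refine (h u w).congr_of_eventuallyEq ?_
  have hx₀ := FiberBundle.mem_baseSet_trivializationAt' (F := E) (E := (TangentSpace I : M → Type _)) x₀
  filter_upwards [(trivializationAt E (TangentSpace I) x₀).open_baseSet.mem_nhds hx₀] with x hx
  exact inCoordinates_bilin_apply (B x) hx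

/-- Evaluation of a smooth field of bilinear forms on smooth vector fields along a map. -/
theorem ContMDiffAt.bilin_apply {B : ∀ x : M, TangentSpace I x →L[ℝ] TangentSpace I x →L[ℝ] ℝ}
    {E' : Type*} [NormedAddCommGroup E'] [NormedSpace ℝ E'] {H' : Type*} [TopologicalSpace H']
    {J : ModelWithCorners ℝ E' H'} {N : Type*} [TopologicalSpace N] [ChartedSpace H' N]
    {b : N → M} {y : N}
    (hB : ContMDiffAt I (I.prod 𝓘(ℝ, E →L[ℝ] E →L[ℝ] ℝ)) ∞
      (fun x ↦ TotalSpace.mk' (E →L[ℝ] E →L[ℝ] ℝ) x (B x)) (b y))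
    (hb : ContMDiffAt J I ∞ b y)
    {u w : ∀ y, TangentSpace I (b y)}
    (hu : ContMDiffAt J I.tangent ∞ (fun y ↦ (⟨b y, u y⟩ : TangentBundle I M)) y)
    (hw : ContMDiffAt J I.tangent ∞ (fun y ↦ (⟨b y, w y⟩ : TangentBundle I M)) y) :
    ContMDiffAt J 𝓘(ℝ, ℝ) ∞ (fun y ↦ B (b y) (u y) (w y)) y := by
  have : ContMDiffAt J (I.prod 𝓘(ℝ)) ∞
      (fun m ↦ TotalSpace.mk' ℝ (E := Bundle.Trivial M ℝ) (b m) (B (b m) (u m) (w m))) y := by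
    apply ContMDiffAt.clm_bundle_apply₂ (F₁ := E) (F₂ := E)
    · exact hB.comp y hb
    · exact hu
    · exact hw
  simp only [contMDiffAt_totalSpace] at this
  exact this.2

/-- The derivative of a smooth real function along a smooth vector field is smooth. -/
theorem ContMDiff.contMDiffAt_mfderiv_apply {f : M → ℝ} (hf : ContMDiff I 𝓘(ℝ, ℝ) ∞ f) {x₀ : M}
    {u : ∀ x : M, TangentSpace I x}
    (hu : ContMDiffAt I I.tangent ∞ (fun x ↦ (⟨x, u x⟩ : TangentBundle I M)) x₀) :
    ContMDiffAt I 𝓘(ℝ, ℝ) ∞ (fun x ↦ (mfderiv I 𝓘(ℝ, ℝ) f x (u x) : ℝ)) x₀ := by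
  have h1 : ContMDiff I.tangent 𝓘(ℝ, ℝ).tangent ∞ (tangentMap I 𝓘(ℝ, ℝ) f) :=
    hf.contMDiff_tangentMap (by simp)
  exact ((contMDiff_snd_tangentBundle_modelSpace ℝ 𝓘(ℝ, ℝ)).contMDiffAt.comp _
    h1.contMDiffAt).comp x₀ hu

/-- The vector field representing a smooth covector field with respect to a smooth nondegenerate
field of bilinear forms is smooth. -/
theorem contMDiffAt_of_bilin_eq [FiniteDimensional ℝ E]
    {B : ∀ x : M, TangentSpace I x →L[ℝ] TangentSpace I x →L[ℝ] ℝ} {x₀ : M}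
    (hB : ContMDiffAt I (I.prod 𝓘(ℝ, E →L[ℝ] E →L[ℝ] ℝ)) ∞
      (fun x ↦ TotalSpace.mk' (E →L[ℝ] E →L[ℝ] ℝ) x (B x)) x₀)
    (hnd : ∀ x v, (∀ w, B x v w = 0) → v = 0) {f : M → ℝ} (hf : ContMDiff I 𝓘(ℝ, ℝ) ∞ f)
    {G : ∀ x : M, TangentSpace I x} (hG : ∀ x w, B x (G x) w = mfderiv I 𝓘(ℝ, ℝ) f x w) :
    ContMDiffAt I I.tangent ∞ (fun x ↦ (⟨x, G x⟩ : TangentBundle I M)) x₀ := by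
  have hx₀ := FiberBundle.mem_baseSet_trivializationAt' (F := E) (E := (TangentSpace I : M → Type _)) x₀
  set e := trivializationAt E (TangentSpace I : M → Type _) x₀ with he
  let L : M → E →L[ℝ] E →L[ℝ] ℝ := fun x ↦
    ContinuousLinearMap.inCoordinates E (TangentSpace I) (E →L[ℝ] ℝ)
      (fun x : M ↦ TangentSpace I x →L[ℝ] ℝ) x₀ x x₀ x (B x)
  have hL : ContMDiffAt I 𝓘(ℝ, E →L[ℝ] E →L[ℝ] ℝ) ∞ L x₀ :=
    ((contMDiffAt_hom_bundle _).1 hB).2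
  have hLapp : ∀ x ∈ e.baseSet, ∀ u w, L x u w = B x (e.symm x u) (e.symm x w) :=
    fun x hx u w ↦ inCoordinates_bilin_apply (B x) hx
  have hsymm : ∀ x ∈ e.baseSet, ∀ v : TangentSpace I x, e.symm x (e ⟨x, v⟩).2 = v :=
    fun x hx v ↦ e.symm_apply_apply_mk hx v
  have hLinv : ∀ x ∈ e.baseSet, (L x).IsInvertible := by
    intro x hx
    refine lorentz_isInvertible fun u hu ↦ ?_
    have h1 : e.symm x u = 0 := hnd x _ fun w ↦ by
      rw [← hsymm x hx w, ← hLapp x hx]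
      exact hu _
    have h2 := e.apply_mk_symm hx u
    rw [h1] at h2
    have h3 : (e ⟨x, (0 : TangentSpace I x)⟩).2 = 0 := by
      have := (e.linearMapAt ℝ x).map_zero
      rwa [Trivialization.linearMapAt_apply, if_pos hx] at this
    rw [h2] at h3
    exact h3
  let α : M → E →L[ℝ] ℝ := fun x ↦ (mfderiv I 𝓘(ℝ, ℝ) f x : TangentSpace I x →L[ℝ] ℝ).comp
    (e.symmL ℝ x)
  have hαapp : ∀ x ∈ e.baseSet, ∀ u, α x u = mfderiv I 𝓘(ℝ, ℝ) f x (e.symm x u) :=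
    fun x hx u ↦ congr_arg (mfderiv I 𝓘(ℝ, ℝ) f x) (e.symmL_apply (R := ℝ) hx u)
  have hα : ContMDiffAt I 𝓘(ℝ, E →L[ℝ] ℝ) ∞ α x₀ := contMDiffAt_clm_of_apply fun u ↦ by
    refine (hf.contMDiffAt_mfderiv_apply (u := constField I x₀ u)
      (contMDiffAt_constField x₀ u)).congr_of_eventuallyEq ?_
    filter_upwards [e.open_baseSet.mem_nhds hx₀] with x hx
    exact hαapp x hx u
  -- In coordinates the represented field is `L(x)⁻¹ α(x)`, and inversion is smooth at invertible
  -- operators.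
  have hinv : ContMDiffAt I 𝓘(ℝ, (E →L[ℝ] ℝ) →L[ℝ] E) ∞
      (fun x ↦ ContinuousLinearMap.inverse (L x)) x₀ :=
    ((hLinv x₀ hx₀).contDiffAt_map_inverse (n := ∞)).contMDiffAt.comp x₀ hL
  refine (e.contMDiffAt_section_iff hx₀).2 ((hinv.clm_apply hα).congr_of_eventuallyEq ?_)
  filter_upwards [e.open_baseSet.mem_nhds hx₀] with x hx
  have h1 : α x = L x (e ⟨x, G x⟩).2 := by
    ext w
    rw [hLapp x hx, hsymm x hx, hG]
    exact hαapp x hx w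
  rw [h1]
  exact ((hLinv x hx).inverse_apply_eq.2 rfl).symm

end TensorSmoothness

namespace Spacetime

variable {m : ℕ} {M : Type*} [TopologicalSpace M]
  [ChartedSpace (EuclideanSpace ℝ (Fin (m + 1))) M] [IsManifold (𝓡 (m + 1)) ∞ M]
  (g : Spacetime m M)

theorem eq_zero_of_metric_eq_zero (x : M) (v : TangentSpace (𝓡 (m + 1)) x)
    (hv : ∀ w, g.metric x v w = 0) : v = 0 := by
  by_contra hne
  obtain ⟨u, -, hu⟩ := g.signature x
  have h := hu v (by rw [g.symm]; exact hv u) hne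
  rw [hv v] at h
  exact lt_irrefl _ h

theorem contMDiff_grad {f : M → ℝ} (hf : ContMDiff (𝓡 (m + 1)) 𝓘(ℝ, ℝ) ∞ f) :
    ContMDiff (𝓡 (m + 1)) (𝓡 (m + 1)).tangent ∞
      (fun x ↦ (⟨x, g.grad f x⟩ : TangentBundle (𝓡 (m + 1)) M)) := fun _ ↦
  contMDiffAt_of_bilin_eq g.contMDiff_metric.contMDiffAt g.eq_zero_of_metric_eq_zero hf
    (g.metric_grad f)

end Spacetime

/-- A function on an interval is strictly increasing as soon as it is so on one-sided
neighborhoods of every point. -/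
theorem strictMonoOn_of_local {I : Set ℝ} (hI : I.OrdConnected) {f : ℝ → ℝ}
    (hr : ∀ s ∈ I, ∃ ε > 0, StrictMonoOn f (Icc s (s + ε)))
    (hl : ∀ s ∈ I, ∃ ε > 0, StrictMonoOn f (Icc (s - ε) s)) : StrictMonoOn f I := by
  intro a ha b hb hab
  -- At `c = sSup S` the left neighborhood carries the inequality to `c` itself, and the right
  -- neighborhood pushes `S` past `c` unless `c = b`.
  let S : Set ℝ := {x | x ∈ Icc a b ∧ ∀ y ∈ Ioc a x, f a < f y}
  have haS : a ∈ S := ⟨⟨le_rfl, hab.le⟩, fun y hy ↦ absurd hy.1 (not_lt.2 hy.2)⟩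
  have hbdd : BddAbove S := ⟨b, fun x hx ↦ hx.1.2⟩
  have hac : a ≤ sSup S := le_csSup hbdd haS
  have hcb : sSup S ≤ b := csSup_le ⟨a, haS⟩ fun x hx ↦ hx.1.2
  set c := sSup S with hc
  have hcI : c ∈ I := hI.out ha hb ⟨hac, hcb⟩
  have hlow : ∀ y, a < y → y < c → f a < f y := by
    intro y hay hyc
    obtain ⟨x, hx, hyx⟩ := exists_lt_of_lt_csSup ⟨a, haS⟩ hyc
    exact hx.2 y ⟨hay, hyx.le⟩
  have hfc : a < c → f a < f c := by
    intro hac'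
    obtain ⟨ε, hε, h⟩ := hl c hcI
    have hm : max ((a + c) / 2) (c - ε) < c := max_lt (by linarith) (by linarith)
    exact (hlow _ (lt_of_lt_of_le (by linarith) (le_max_left _ _)) hm).trans
      (h ⟨le_max_right _ _, hm.le⟩ ⟨by linarith, le_rfl⟩ hm)
  rcases hcb.eq_or_lt with h | hlt
  · rw [← h]
    exact hfc (by rw [h]; exact hab)
  · exfalso
    obtain ⟨ε, hε, h⟩ := hr c hcI
    have hle : f a ≤ f c := by
      rcases hac.eq_or_lt with h' | h'
      · rw [← h']
      · exact (hfc h').le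
    have hcd : c < min b (c + ε) := lt_min hlt (by linarith)
    have hmem : min b (c + ε) ∈ S := by
      refine ⟨⟨hac.trans hcd.le, min_le_left _ _⟩, fun y hy ↦ ?_⟩
      rcases le_or_gt y c with hyc | hyc
      · rcases hyc.eq_or_lt with h' | h'
        · rw [h']
          exact hfc (h' ▸ hy.1)
        · exact hlow y hy.1 h'
      · exact hle.trans_lt (h ⟨le_rfl, by linarith⟩ ⟨hyc.le, hy.2.trans (min_le_right _ _)⟩ hyc)
    exact absurd (le_csSup hbdd hmem) (not_le.2 hcd)

/-! ### Gradients, time cones and weakly temporal functions. -/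

namespace Spacetime

variable {m : ℕ} {M : Type*} [TopologicalSpace M]
  [ChartedSpace (EuclideanSpace ℝ (Fin (m + 1))) M] [IsManifold (𝓡 (m + 1)) ∞ M]
  {g : Spacetime m M}

theorem grad_eq {f : M → ℝ} {x : M} {v : TangentSpace (𝓡 (m + 1)) x}
    (h : ∀ w, g.metric x v w = mfderiv (𝓡 (m + 1)) 𝓘(ℝ, ℝ) f x w) : g.grad f x = v :=
  (g.existsUnique_metric_eq x (mfderiv (𝓡 (m + 1)) 𝓘(ℝ, ℝ) f x)).unique (g.metric_grad f x) h

theorem grad_congr {f f' : M → ℝ} {x : M} (h : f =ᶠ[𝓝 x] f') : g.grad f x = g.grad f' x :=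
  grad_eq fun w ↦ by rw [metric_grad, h.mfderiv_eq]; rfl

theorem grad_add {f f' : M → ℝ} {x : M} (hf : MDifferentiableAt (𝓡 (m + 1)) 𝓘(ℝ, ℝ) f x)
    (hf' : MDifferentiableAt (𝓡 (m + 1)) 𝓘(ℝ, ℝ) f' x) :
    g.grad (f + f') x = g.grad f x + g.grad f' x :=
  grad_eq fun w ↦ by
    rw [map_add, add_apply, metric_grad, metric_grad, mfderiv_add hf hf']
    rfl

theorem grad_const (c : ℝ) (x : M) : g.grad (fun _ ↦ c) x = 0 :=
  grad_eq fun w ↦ by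
    rw [map_zero, mfderiv_const]
    rfl

theorem PastTimelike.add {x : M} {v w : TangentSpace (𝓡 (m + 1)) x} (hv : g.PastTimelike v)
    (hw : g.PastTimelike w) : g.PastTimelike (v + w) :=
  lorentz_add_neg (g.symm x) (g.signature x) (g.timelike_timeField x) hv.1 hw.1 hv.2 hw.2

theorem FutureTimelike.neg {x : M} {v : TangentSpace (𝓡 (m + 1)) x} (hv : g.FutureTimelike v) :
    g.PastTimelike (-v) := by
  obtain ⟨h1, h2⟩ := hv
  constructor
  · simpa using h1
  · simpa using h2

theorem PastTimelike.metric_pos {x : M} {v w : TangentSpace (𝓡 (m + 1)) x}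
    (hv : g.PastTimelike v) (hw : g.FutureTimelike w) : 0 < g.metric x v w := by
  have hw' := hw.neg
  have := lorentz_neg_of_same_cone (g.symm x) (g.signature x) (g.timelike_timeField x) hv.1 hw'.1
    hv.2 hw'.2
  rw [map_neg] at this
  linarith

/-- The functions whose gradient is timelike and past-pointing wherever it does not vanish. -/
def IsWeaklyTemporal (g : Spacetime m M) (f : M → ℝ) : Prop :=
  ContMDiff (𝓡 (m + 1)) 𝓘(ℝ, ℝ) ∞ f ∧ ∀ x, g.grad f x = 0 ∨ g.PastTimelike (g.grad f x)

theorem isWeaklyTemporal_const (c : ℝ) : g.IsWeaklyTemporal (fun _ ↦ c) :=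
  ⟨contMDiff_const, fun x ↦ .inl (grad_const c x)⟩

theorem IsWeaklyTemporal.add {f f' : M → ℝ} (hf : g.IsWeaklyTemporal f)
    (hf' : g.IsWeaklyTemporal f') : g.IsWeaklyTemporal (f + f') := by
  refine ⟨hf.1.add hf'.1, fun x ↦ ?_⟩
  rw [grad_add (hf.1.mdifferentiable (by simp) x) (hf'.1.mdifferentiable (by simp) x)]
  rcases hf.2 x with h | h <;> rcases hf'.2 x with h' | h'
  · left; rw [h, h', add_zero]
  · right; rwa [h, zero_add]
  · right; rwa [h', add_zero]
  · exact .inr (h.add h')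

theorem IsWeaklyTemporal.pastTimelike_add {f f' : M → ℝ} (hf : g.IsWeaklyTemporal f)
    (hf' : g.IsWeaklyTemporal f') {x : M} (h : g.PastTimelike (g.grad f x)) :
    g.PastTimelike (g.grad (f + f') x) := by
  rw [grad_add (hf.1.mdifferentiable (by simp) x) (hf'.1.mdifferentiable (by simp) x)]
  rcases hf'.2 x with h' | h'
  · rwa [h', add_zero]
  · exact h.add h'

theorem IsWeaklyTemporal.sum {ι : Type*} {f : ι → M → ℝ} (hf : ∀ i, g.IsWeaklyTemporal (f i))
    (s : Finset ι) : g.IsWeaklyTemporal (∑ i ∈ s, f i) := by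
  classical
  induction s using Finset.induction_on with
  | empty => exact isWeaklyTemporal_const 0
  | insert i s his ih => rw [Finset.sum_insert his]; exact (hf i).add ih

theorem IsWeaklyTemporal.pastTimelike_sum {ι : Type*} {f : ι → M → ℝ}
    (hf : ∀ i, g.IsWeaklyTemporal (f i)) {s : Finset ι} {i : ι} (hi : i ∈ s) {x : M}
    (h : g.PastTimelike (g.grad (f i) x)) : g.PastTimelike (g.grad (∑ i ∈ s, f i) x) := by
  classical
  rw [← Finset.add_sum_erase s f hi]
  exact (hf i).pastTimelike_add (.sum hf _) h

/-- A nonzero gradient is detected by one vector `w`; extending `w` with constant coordinates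
reduces the claim to continuity of a real function. Consequently points of nonzero gradient are
interior to `gradSupport`, where the cone condition on step functions holds. -/
theorem isOpen_grad_ne_zero {f : M → ℝ} (hf : ContMDiff (𝓡 (m + 1)) 𝓘(ℝ, ℝ) ∞ f) :
    IsOpen {x | g.grad f x ≠ 0} := by
  refine isOpen_iff_mem_nhds.2 fun x hx ↦ ?_
  obtain ⟨w, hw⟩ : ∃ w, g.metric x (g.grad f x) w ≠ 0 := by
    by_contra! h
    exact hx (g.eq_zero_of_metric_eq_zero x _ h)
  have hx₀ := FiberBundle.mem_baseSet_trivializationAt' (F := EuclideanSpace ℝ (Fin (m + 1)))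
    (E := (TangentSpace (𝓡 (m + 1)) : M → Type _)) x
  let e := trivializationAt (EuclideanSpace ℝ (Fin (m + 1)))
    (TangentSpace (𝓡 (m + 1)) : M → Type _) x
  have hc : constField (𝓡 (m + 1)) x (e ⟨x, w⟩).2 x = w := e.symm_apply_apply_mk hx₀ w
  have h := (hf.contMDiffAt_mfderiv_apply (contMDiffAt_constField (I := 𝓡 (m + 1)) x
    (e ⟨x, w⟩).2)).continuousAt
  have hne := h.eventually_ne (y := (0 : ℝ)) (by rw [hc, ← metric_grad]; exact hw)
  filter_upwards [hne] with y hy h0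
  apply hy
  rw [← metric_grad, h0, map_zero]
  rfl

theorem IsTemporalStepFunction.isWeaklyTemporal {t : M → ℝ} {c c₁ a b c₂ : ℝ} {τ : M → ℝ}
    (h : g.IsTemporalStepFunction t c c₁ a b c₂ τ) : g.IsWeaklyTemporal τ := by
  refine ⟨h.contMDiff, fun x ↦ or_iff_not_imp_left.2 fun hx ↦ h.pastTimelike_grad x ?_⟩
  exact interior_maximal subset_closure (isOpen_grad_ne_zero h.contMDiff) hx


/-! ### Timelike curves -/

theorem isTimelikeSegment_of_hasMFDerivAt {X : ∀ x : M, TangentSpace (𝓡 (m + 1)) x}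
    (hX : ∀ x, g.FutureTimelike (X x)) {γ : ℝ → M} {a b : ℝ} (hab : a < b)
    (hγ : ∀ s ∈ Icc a b, HasMFDerivAt 𝓘(ℝ, ℝ) (𝓡 (m + 1)) γ s
      ((1 : ℝ →L[ℝ] ℝ).smulRight (X (γ s))))
    (hsm : ∀ s ∈ Icc a b, ContMDiffAt 𝓘(ℝ, ℝ) (𝓡 (m + 1)) ∞ γ s) :
    g.IsTimelikeSegment γ a b := by
  refine ⟨hab, fun s hs ↦ (hsm s hs).contMDiffWithinAt, fun s hs ↦ ?_⟩
  have h : mfderivWithin 𝓘(ℝ, ℝ) (𝓡 (m + 1)) γ (Icc a b) s (1 : ℝ) = X (γ s) := by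
    rw [((hγ s hs).hasMFDerivWithinAt).mfderivWithin
      ((uniqueDiffOn_Icc hab) s hs).uniqueMDiffWithinAt]
    exact one_smul ℝ (X (γ s))
  rw [h]
  exact hX _

theorem IsTimelikeSegment.isCausalSegment {γ : ℝ → M} {a b : ℝ}
    (h : g.IsTimelikeSegment γ a b) : g.IsCausalSegment γ a b := by
  refine ⟨h.1, h.2.1, fun s hs ↦ ?_⟩
  obtain ⟨h1, h2⟩ := h.2.2 s hs
  refine ⟨fun h0 ↦ ?_, h1.le, h2⟩
  rw [h0, map_zero] at h1
  exact lt_irrefl _ h1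

/-- The inextendible integral curves of a future timelike vector field. -/
theorem exists_isInextendibleTimelikeCurve [T2Space M] {X : ∀ x : M, TangentSpace (𝓡 (m + 1)) x}
    (hX : ∀ x, g.FutureTimelike (X x))
    (hXs : ContMDiff (𝓡 (m + 1)) (𝓡 (m + 1)).tangent ∞
      (fun x ↦ (⟨x, X x⟩ : TangentBundle (𝓡 (m + 1)) M))) (p : M) :
    ∃ (I : Set ℝ) (γ : ℝ → M), g.IsInextendibleTimelikeCurve I γ ∧ (0 : ℝ) ∈ I ∧ γ 0 = p ∧
      (∀ s ∈ I, HasMFDerivAt 𝓘(ℝ, ℝ) (𝓡 (m + 1)) γ s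
        ((1 : ℝ →L[ℝ] ℝ).smulRight (X (γ s)))) ∧
      ∀ s ∈ I, ContMDiffAt 𝓘(ℝ, ℝ) (𝓡 (m + 1)) ∞ γ s := by
  have hX0 : ∀ x, X x ≠ 0 := by
    intro x h0
    have := (hX x).1
    rw [h0, map_zero] at this
    exact lt_irrefl _ this
  obtain ⟨I, γ, hIo, hIc, h0, hp, hd, hs, hf, hpa⟩ := exists_inextendible_integralCurve hXs hX0 p
  refine ⟨I, γ, ⟨hIo, hIc, ⟨0, h0⟩, fun s hsI ↦ ?_, fun s hsI ↦ ?_, hf, hpa⟩, h0, hp, hd, hs⟩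
  · obtain ⟨ε, hε, hball⟩ := Metric.isOpen_iff.1 hIo s hsI
    have hm : s + ε / 2 ∈ I := hball (by
      rw [Metric.mem_ball, Real.dist_eq, add_sub_cancel_left, abs_of_pos] <;> linarith)
    exact ⟨ε / 2, by linarith, hm, isTimelikeSegment_of_hasMFDerivAt hX (by linarith)
      (fun r hr ↦ hd r (hIc.out hsI hm hr)) (fun r hr ↦ hs r (hIc.out hsI hm hr))⟩
  · obtain ⟨ε, hε, hball⟩ := Metric.isOpen_iff.1 hIo s hsI
    have hm : s - ε / 2 ∈ I := hball (by
      rw [Metric.mem_ball, Real.dist_eq, sub_sub_cancel_left, abs_neg, abs_of_pos] <;> linarith)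
    exact ⟨ε / 2, by linarith, hm, isTimelikeSegment_of_hasMFDerivAt hX (by linarith)
      (fun r hr ↦ hd r (hIc.out hm hsI hr)) (fun r hr ↦ hs r (hIc.out hm hsI hr))⟩

theorem IsInextendibleTimelikeCurve.strictMonoOn {I : Set ℝ} {γ : ℝ → M}
    (h : g.IsInextendibleTimelikeCurve I γ) {f : M → ℝ}
    (hf : ∀ a b, g.IsTimelikeSegment γ a b → StrictMonoOn (fun s ↦ f (γ s)) (Icc a b)) :
    StrictMonoOn (fun s ↦ f (γ s)) I := by
  refine strictMonoOn_of_local h.ordConnected (fun s hs ↦ ?_) fun s hs ↦ ?_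
  · obtain ⟨ε, hε, -, h'⟩ := h.timelike_right s hs
    exact ⟨ε, hε, hf _ _ h'⟩
  · obtain ⟨ε, hε, -, h'⟩ := h.timelike_left s hs
    exact ⟨ε, hε, hf _ _ h'⟩

theorem IsInextendibleTimelikeCurve.continuousOn {I : Set ℝ} {γ : ℝ → M}
    (h : g.IsInextendibleTimelikeCurve I γ) : ContinuousOn γ I := by
  intro s hs
  obtain ⟨ε, hε, -, -, hr, -⟩ := h.timelike_right s hs
  obtain ⟨δ, hδ, -, -, hl, -⟩ := h.timelike_left s hs
  refine ContinuousAt.continuousWithinAt (continuousAt_iff_continuous_left_right.2 ⟨?_, ?_⟩)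
  · exact (hl.continuousOn s ⟨by linarith, le_rfl⟩).mono_of_mem_nhdsWithin
      (Icc_mem_nhdsLE (by linarith))
  · exact (hr.continuousOn s ⟨le_rfl, by linarith⟩).mono_of_mem_nhdsWithin
      (Icc_mem_nhdsGE (by linarith))

/-- A function with past-pointing timelike gradient increases along timelike curves. -/
theorem IsTimelikeSegment.strictMonoOn {f : M → ℝ} (hf : ContMDiff (𝓡 (m + 1)) 𝓘(ℝ, ℝ) ∞ f)
    (hgrad : ∀ x, g.PastTimelike (g.grad f x)) {γ : ℝ → M} {a b : ℝ}
    (h : g.IsTimelikeSegment γ a b) : StrictMonoOn (fun s ↦ f (γ s)) (Icc a b) := by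
  refine strictMonoOn_of_deriv_pos (convex_Icc a b)
    (hf.continuous.comp_continuousOn h.2.1.continuousOn) fun s hs ↦ ?_
  have hs' : s ∈ Icc a b := interior_subset hs
  have hn : Icc a b ∈ 𝓝 s := mem_interior_iff_mem_nhds.1 hs
  have hγ : MDifferentiableAt 𝓘(ℝ, ℝ) (𝓡 (m + 1)) γ s :=
    (((h.2.1 s hs').contMDiffAt hn).mdifferentiableAt (by simp))
  have hd := ((hf.mdifferentiable (by simp) (γ s)).hasMFDerivAt.comp s hγ.hasMFDerivAt)
  have h2 : deriv (fun s ↦ f (γ s)) s = mfderiv (𝓡 (m + 1)) 𝓘(ℝ, ℝ) f (γ s)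
      (mfderiv 𝓘(ℝ, ℝ) (𝓡 (m + 1)) γ s (1 : ℝ)) := by
    have hd' := hd.mfderiv
    rw [mfderiv_eq_fderiv] at hd'
    exact fderiv_apply_one_eq_deriv.symm.trans (DFunLike.congr_fun hd' (1 : ℝ))
  rw [h2, ← metric_grad]
  refine (hgrad _).metric_pos ?_
  have := h.2.2 s hs'
  rwa [mfderivWithin_of_mem_nhds hn] at this

/-- A function with past-pointing timelike gradient which takes all values on inextendible
timelike curves has Cauchy levels. -/
theorem isCauchy_of_pastTimelike_grad {f : M → ℝ} (hf : ContMDiff (𝓡 (m + 1)) 𝓘(ℝ, ℝ) ∞ f)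
    (hgrad : ∀ x, g.PastTimelike (g.grad f x))
    (hsurj : ∀ I γ, g.IsInextendibleTimelikeCurve I γ → ∀ c, ∃ s ∈ I, f (γ s) = c) (c : ℝ) :
    g.IsCauchy (f ⁻¹' {c}) := by
  intro I γ h
  obtain ⟨s, hs, hc⟩ := hsurj I γ h c
  exact ⟨s, ⟨hs, hc⟩, fun r hr ↦
    (h.strictMonoOn fun a b hab ↦ hab.strictMonoOn hf hgrad).injOn hr.1 hs (hr.2.trans hc.symm)⟩

/-! ### Cauchy time functions along inextendible timelike curves. -/

namespace IsCauchyTimeFunction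

variable {t : M → ℝ}

theorem strictMonoOn_curve (ht : g.IsCauchyTimeFunction t) {I : Set ℝ} {γ : ℝ → M}
    (h : g.IsInextendibleTimelikeCurve I γ) : StrictMonoOn (fun s ↦ t (γ s)) I :=
  h.strictMonoOn fun a b hab ↦ ht.strictMonoOn γ a b hab.isCausalSegment

theorem exists_eq_on_curve (ht : g.IsCauchyTimeFunction t) {I : Set ℝ} {γ : ℝ → M}
    (h : g.IsInextendibleTimelikeCurve I γ) (c : ℝ) : ∃ s ∈ I, t (γ s) = c := by
  obtain ⟨s, ⟨hs, hc⟩, -⟩ := ht.isCauchy c I γ h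
  exact ⟨s, hs, hc⟩

variable [T2Space M]

/-- The integral curve of the time-orienting field through `p` crosses the Cauchy level `t = c`, and
monotonicity of `t` places the crossing before `p`. This converts the causal conditions on step
functions into inequalities on `t`. -/
theorem mem_causalFuture (ht : g.IsCauchyTimeFunction t) {c : ℝ} {p : M} (hp : c ≤ t p) :
    p ∈ g.causalFuture (t ⁻¹' {c}) := by
  have hX : ∀ x, g.FutureTimelike (g.timeField x) :=
    fun x ↦ ⟨g.timelike_timeField x, g.timelike_timeField x⟩
  obtain ⟨I, γ, hI, h0, hγ0, hd, hs⟩ :=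
    exists_isInextendibleTimelikeCurve hX g.contMDiff_timeField p
  obtain ⟨s, hsI, hsc⟩ := ht.exists_eq_on_curve hI c
  refine ⟨γ s, hsc, ?_⟩
  have hs0 : s ≤ 0 := by
    rw [← (ht.strictMonoOn_curve hI).le_iff_le hsI h0]
    simpa [hsc, hγ0] using hp
  rcases hs0.eq_or_lt with h | h
  · rw [h, hγ0]
    exact Relation.ReflTransGen.refl
  · refine Relation.ReflTransGen.single ⟨γ, s, 0, ?_, rfl, hγ0⟩
    exact (isTimelikeSegment_of_hasMFDerivAt hX h
      (fun r hr ↦ hd r (hI.ordConnected.out hsI h0 hr))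
      (fun r hr ↦ hs r (hI.ordConnected.out hsI h0 hr))).isCausalSegment

theorem mem_causalPast (ht : g.IsCauchyTimeFunction t) {c : ℝ} {p : M} (hp : t p ≤ c) :
    p ∈ g.causalPast (t ⁻¹' {c}) := by
  have hX : ∀ x, g.FutureTimelike (g.timeField x) :=
    fun x ↦ ⟨g.timelike_timeField x, g.timelike_timeField x⟩
  obtain ⟨I, γ, hI, h0, hγ0, hd, hs⟩ :=
    exists_isInextendibleTimelikeCurve hX g.contMDiff_timeField p
  obtain ⟨s, hsI, hsc⟩ := ht.exists_eq_on_curve hI c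
  refine ⟨γ s, hsc, ?_⟩
  have hs0 : 0 ≤ s := by
    rw [← (ht.strictMonoOn_curve hI).le_iff_le h0 hsI]
    simpa [hsc, hγ0] using hp
  rcases hs0.eq_or_lt with h | h
  · rw [← h, hγ0]
    exact Relation.ReflTransGen.refl
  · refine Relation.ReflTransGen.single ⟨γ, 0, s, ?_, hγ0, rfl⟩
    exact (isTimelikeSegment_of_hasMFDerivAt hX h
      (fun r hr ↦ hd r (hI.ordConnected.out h0 hsI hr))
      (fun r hr ↦ hs r (hI.ordConnected.out h0 hsI hr))).isCausalSegment

end IsCauchyTimeFunction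

end Spacetime

/-! ### Construction of the temporal function. -/

namespace Spacetime

variable {m : ℕ} {M : Type*} [TopologicalSpace M] [T2Space M]
  [ChartedSpace (EuclideanSpace ℝ (Fin (m + 1))) M] [IsManifold (𝓡 (m + 1)) ∞ M]
  {g : Spacetime m M} {t : M → ℝ}

/-- A finite sum of temporal step functions whose gradient does not vanish on the slab
`n ≤ t ≤ n + 1`. -/
theorem exists_sum_stepFunction (ht : g.IsCauchyTimeFunction t)
    (hstep : ∀ c : ℝ, ∃ (a b : ℝ) (τ : M → ℝ),
      g.IsTemporalStepFunction t c (c - 2) a b (c + 2) τ) (n : ℝ) :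
    ∃ (f : M → ℝ) (k : ℝ), 1 ≤ k ∧ g.IsWeaklyTemporal f ∧ (∀ x, f x ∈ Icc (-k) k) ∧
      (∀ x, n + 3 ≤ t x → f x = k) ∧ (∀ x, t x ≤ n - 2 → f x = -k) ∧
      ∀ x, t x ∈ Icc n (n + 1) → g.PastTimelike (g.grad f x) := by
  choose a b τ hτ using hstep
  -- The centres lie in `[n, n + 1]`, so all outer extremes lie in `[n - 2, n + 3]`; beyond these
  -- values of `t` every summand equals `1` or `-1`, whence `k = F.card`.
  obtain ⟨F, hF, hcov⟩ := (isCompact_Icc (a := n) (b := n + 1)).elim_nhds_subcover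
    (fun c ↦ Ioo (a c) (b c)) fun c _ ↦ Ioo_mem_nhds (hτ c).extremes.2.1 (hτ c).extremes.2.2.1
  have hw : ∀ c, g.IsWeaklyTemporal (τ c) := fun c ↦ (hτ c).isWeaklyTemporal
  have hcard : 1 ≤ F.card := by
    obtain ⟨c, hc, -⟩ := mem_iUnion₂.1 (hcov (left_mem_Icc.2 (by linarith : n ≤ n + 1)))
    exact Finset.card_pos.2 ⟨c, hc⟩
  refine ⟨∑ c ∈ F, τ c, F.card, by exact_mod_cast hcard, .sum hw F, fun x ↦ ?_, fun x hx ↦ ?_,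
    fun x hx ↦ ?_, fun x hx ↦ ?_⟩
  · rw [Finset.sum_apply]
    refine abs_le.1 <| (Finset.abs_sum_le_sum_abs _ _).trans ((Finset.sum_le_card_nsmul F _ 1
      fun c _ ↦ abs_le.2 ((hτ c).mem_Icc x)).trans (by simp))
  · rw [Finset.sum_apply, Finset.sum_congr rfl fun c hc ↦
      (hτ c).eq_one x (ht.mem_causalFuture (by linarith [(hF c hc).2]))]
    simp
  · rw [Finset.sum_apply, Finset.sum_congr rfl fun c hc ↦
      (hτ c).eq_neg_one x (ht.mem_causalPast (by linarith [(hF c hc).1]))]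
    simp
  · obtain ⟨c, hc, hxc⟩ := mem_iUnion₂.1 (hcov hx)
    exact IsWeaklyTemporal.pastTimelike_sum hw hc
      ((hτ c).pastTimelike_grad x ((hτ c).level_subset _ hxc rfl))

/-- The step functions of `exists_sum_stepFunction`, normalized so that only finitely many of
them are nonzero on each bounded slab. -/
theorem exists_normalized_stepFunction (ht : g.IsCauchyTimeFunction t)
    (hstep : ∀ c : ℝ, ∃ (a b : ℝ) (τ : M → ℝ),
      g.IsTemporalStepFunction t c (c - 2) a b (c + 2) τ) (n : ℤ) :
    ∃ f : M → ℝ, g.IsWeaklyTemporal f ∧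
      (∀ x, t x ∈ Icc (n : ℝ) (n + 1) → g.PastTimelike (g.grad f x)) ∧
      (0 ≤ n → (∀ x, 0 ≤ f x) ∧ (∀ x, t x ≤ n - 2 → f x = 0) ∧ ∀ x, n + 3 ≤ t x → 1 ≤ f x) ∧
      (n < 0 → (∀ x, f x ≤ 0) ∧ (∀ x, n + 3 ≤ t x → f x = 0) ∧ ∀ x, t x ≤ n - 2 → f x ≤ -1) := by
  obtain ⟨f, k, hk, hw, hI, h1, h2, hp⟩ := exists_sum_stepFunction ht hstep n
  -- The constant added is `k` for `n ≥ 0` and `-k` for `n < 0`, so that the function vanishes on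
  -- the side facing `t = 0`.
  rcases le_or_gt 0 n with hn | hn
  · refine ⟨f + fun _ ↦ k, hw.add (isWeaklyTemporal_const k),
      fun x hx ↦ hw.pastTimelike_add (isWeaklyTemporal_const k) (hp x hx),
      fun _ ↦ ⟨fun x ↦ ?_, fun x hx ↦ ?_, fun x hx ↦ ?_⟩, fun h ↦ absurd hn (not_le.2 h)⟩
    · have := (hI x).1
      simp only [Pi.add_apply]
      linarith
    · simp [h2 x hx]
    · simp only [Pi.add_apply, h1 x hx]
      linarith
  · refine ⟨f + fun _ ↦ -k, hw.add (isWeaklyTemporal_const (-k)),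
      fun x hx ↦ hw.pastTimelike_add (isWeaklyTemporal_const (-k)) (hp x hx),
      fun h ↦ absurd hn (not_lt.2 h), fun _ ↦ ⟨fun x ↦ ?_, fun x hx ↦ ?_, fun x hx ↦ ?_⟩⟩
    · have := (hI x).2
      simp only [Pi.add_apply]
      linarith
    · simp [h1 x hx]
    · simp only [Pi.add_apply, h2 x hx]
      linarith

/-- A temporal function which tends to `±∞` with the Cauchy time function. -/
theorem exists_temporalFunction (ht : g.IsCauchyTimeFunction t)
    (hstep : ∀ c : ℝ, ∃ (a b : ℝ) (τ : M → ℝ),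
      g.IsTemporalStepFunction t c (c - 2) a b (c + 2) τ) :
    ∃ T : M → ℝ, ContMDiff (𝓡 (m + 1)) 𝓘(ℝ, ℝ) ∞ T ∧ (∀ x, g.PastTimelike (g.grad T x)) ∧
      (∀ N : ℕ, ∀ x, N + 3 ≤ t x → N ≤ T x) ∧ ∀ N : ℕ, ∀ x, t x ≤ -N - 3 → T x ≤ -N := by
  choose f hw hp hpos hneg using exists_normalized_stepFunction ht hstep
  have hsupp : ∀ (N : ℕ) (x : M), |t x| < N →
      (Function.support fun n ↦ f n x) ⊆ (Finset.Icc (-(N + 3) : ℤ) (N + 3) : Finset ℤ) := by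
    intro N x hx n hne
    rw [abs_lt] at hx
    rw [Finset.coe_Icc]
    rcases le_or_gt 0 n with hn | hn
    · have h : (n : ℝ) < N + 3 := by
        by_contra! h
        exact hne ((hpos n hn).2.1 x (by linarith [hx.2]))
      have h' : n < N + 3 := by exact_mod_cast h
      constructor <;> omega
    · have h : (-(N + 3) : ℝ) < n := by
        by_contra! h
        exact hne ((hneg n hn).2.1 x (by linarith [hx.1]))
      have h' : -(N + 3) < n := by exact_mod_cast h
      constructor <;> omega
  have hT : ∀ (N : ℕ) (x : M), |t x| < N →
      ∑ᶠ n, f n x = (∑ n ∈ Finset.Icc (-(N + 3) : ℤ) (N + 3), f n) x := by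
    intro N x hx
    rw [Finset.sum_apply]
    exact finsum_eq_sum_of_support_subset _ (hsupp N x hx)
  have hloc : ∀ x, ∃ N : ℕ, |t x| < N ∧
      (fun x ↦ ∑ᶠ n, f n x) =ᶠ[𝓝 x] ∑ n ∈ Finset.Icc (-(N + 3) : ℤ) (N + 3), f n := by
    intro x
    obtain ⟨N, hN⟩ := exists_nat_gt |t x|
    refine ⟨N, hN, ?_⟩
    filter_upwards [(ht.continuous.abs.isOpen_preimage _ isOpen_Iio).mem_nhds hN] with y hy
    exact hT N y hy
  refine ⟨fun x ↦ ∑ᶠ n, f n x, fun x ↦ ?_, fun x ↦ ?_, fun K x hx ↦ ?_, fun K x hx ↦ ?_⟩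
  · obtain ⟨N, -, h⟩ := hloc x
    exact ((IsWeaklyTemporal.sum hw _).1 x).congr_of_eventuallyEq h
  · obtain ⟨N, hN, h⟩ := hloc x
    rw [grad_congr h]
    -- The point `x` lies in the slab of index `⌊t x⌋`, and that single term makes the gradient of
    -- the sum timelike.
    refine IsWeaklyTemporal.pastTimelike_sum hw (i := ⌊t x⌋) ?_
      (hp _ x ⟨Int.floor_le _, (Int.lt_floor_add_one _).le⟩)
    rw [abs_lt] at hN
    have h1 : (-(N + 1) : ℤ) ≤ ⌊t x⌋ := Int.le_floor.2 (by push_cast; linarith [hN.1])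
    have h2 : ⌊t x⌋ < (N : ℤ) := Int.floor_lt.2 (by exact_mod_cast hN.2)
    rw [Finset.mem_Icc]
    constructor <;> omega
  · obtain ⟨N, hN⟩ := exists_nat_gt |t x|
    have hKN : K < N := by
      have : (K : ℝ) < N := by linarith [le_abs_self (t x)]
      exact_mod_cast this
    change (K : ℝ) ≤ ∑ᶠ n, f n x
    rw [hT N x hN, Finset.sum_apply]
    -- For `t x ≥ K + 3` the `K` terms with `0 ≤ n < K` are at least `1`, the other nonnegative
    -- indices contribute nonnegatively, and the negative indices contribute zero.
    calc (K : ℝ) = ∑ n ∈ Finset.Ico (0 : ℤ) K, (1 : ℝ) := by simp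
      _ ≤ ∑ n ∈ Finset.Ico (0 : ℤ) K, f n x := by
        refine Finset.sum_le_sum fun n hn ↦ ?_
        rw [Finset.mem_Ico] at hn
        have : (n : ℝ) < K := by exact_mod_cast hn.2
        exact (hpos n hn.1).2.2 x (by linarith)
      _ ≤ _ := by
        refine Finset.sum_le_sum_of_subset_of_nonneg (fun n hn ↦ ?_) fun n _ _ ↦ ?_
        · rw [Finset.mem_Ico] at hn
          rw [Finset.mem_Icc]
          constructor <;> omega
        · rcases le_or_gt 0 n with hn | hn
          · exact (hpos n hn).1 x
          · have : (n : ℝ) < 0 := by exact_mod_cast hn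
            exact ((hneg n hn).2.1 x (by linarith [K.cast_nonneg (α := ℝ)])).ge
  · obtain ⟨N, hN⟩ := exists_nat_gt |t x|
    have hKN : K < N := by
      have : (K : ℝ) < N := by linarith [neg_le_abs (t x)]
      exact_mod_cast this
    change ∑ᶠ n, f n x ≤ (-K : ℝ)
    rw [hT N x hN, Finset.sum_apply, ← neg_le_neg_iff, neg_neg, ← Finset.sum_neg_distrib]
    calc (K : ℝ) = ∑ n ∈ Finset.Ico (-K : ℤ) 0, (1 : ℝ) := by simp
      _ ≤ ∑ n ∈ Finset.Ico (-K : ℤ) 0, -f n x := by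
        refine Finset.sum_le_sum fun n hn ↦ ?_
        rw [Finset.mem_Ico] at hn
        have : (-K : ℝ) ≤ n := by exact_mod_cast hn.1
        linarith [(hneg n hn.2).2.2 x (by linarith)]
      _ ≤ _ := by
        refine Finset.sum_le_sum_of_subset_of_nonneg (fun n hn ↦ ?_) fun n _ _ ↦ ?_
        · rw [Finset.mem_Ico] at hn
          rw [Finset.mem_Icc]
          constructor <;> omega
        · rw [neg_nonneg]
          rcases le_or_gt 0 n with hn | hn
          · have : (0 : ℝ) ≤ n := by exact_mod_cast hn
            exact ((hpos n hn).2.1 x (by linarith [K.cast_nonneg (α := ℝ)])).le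
          · exact (hneg n hn).1 x

omit [T2Space M] in
-- All levels of `t` are met by `γ`, so the reparameterization `σ` is determined on all of `ℝ` and
-- satisfies `t (σ c) = c`.
theorem IsCauchyTimeFunction.tendsto_temporalFunction (ht : g.IsCauchyTimeFunction t) {T : M → ℝ}
    (hT : (∀ N : ℕ, ∀ x, N + 3 ≤ t x → N ≤ T x) ∧ ∀ N : ℕ, ∀ x, t x ≤ -N - 3 → T x ≤ -N)
    {I : Set ℝ} {γ : ℝ → M} (h : g.IsInextendibleTimelikeCurve I γ) {σ : ℝ → M}
    (hσ : ∀ s ∈ I, σ (t (γ s)) = γ s) :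
    Tendsto (fun s ↦ T (σ s)) atTop atTop ∧ Tendsto (fun s ↦ T (σ s)) atBot atBot := by
  have hσt : ∀ c, t (σ c) = c := by
    intro c
    obtain ⟨s, hs, rfl⟩ := ht.exists_eq_on_curve h c
    rw [hσ s hs]
  constructor
  · refine tendsto_atTop.2 fun C ↦ ?_
    obtain ⟨N, hN⟩ := exists_nat_ge C
    filter_upwards [eventually_ge_atTop (N + 3 : ℝ)] with c hc
    exact hN.trans (hT.1 N _ (by rwa [hσt]))
  · refine tendsto_atBot.2 fun C ↦ ?_
    obtain ⟨N, hN⟩ := exists_nat_ge (-C)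
    filter_upwards [eventually_le_atBot (-N - 3 : ℝ)] with c hc
    exact (hT.2 N _ (by rwa [hσt])).trans (by linarith)

omit [T2Space M] in
theorem IsCauchyTimeFunction.exists_temporalFunction_eq (ht : g.IsCauchyTimeFunction t) {T : M → ℝ}
    (hTc : Continuous T)
    (hT : (∀ N : ℕ, ∀ x, N + 3 ≤ t x → N ≤ T x) ∧ ∀ N : ℕ, ∀ x, t x ≤ -N - 3 → T x ≤ -N)
    {I : Set ℝ} {γ : ℝ → M} (h : g.IsInextendibleTimelikeCurve I γ) (c : ℝ) :
    ∃ s ∈ I, T (γ s) = c := by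
  obtain ⟨N, hN⟩ := exists_nat_ge |c|
  rw [abs_le] at hN
  obtain ⟨a, ha, hta⟩ := ht.exists_eq_on_curve h (-N - 3)
  obtain ⟨b, hb, htb⟩ := ht.exists_eq_on_curve h (N + 3)
  exact h.ordConnected.isPreconnected.intermediate_value ha hb
    (hTc.comp_continuousOn h.continuousOn)
    ⟨(hT.2 N _ hta.le).trans hN.1, hN.2.trans (hT.1 N _ htb.ge)⟩

end Spacetime

/-! ### Regular level sets as embedded hypersurfaces. -/

/-- A nonzero linear form is the last coordinate in some linear coordinate system. -/
theorem exists_continuousLinearEquiv_snd_eq {E F : Type*} [NormedAddCommGroup E] [NormedSpace ℝ E]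
    [FiniteDimensional ℝ E] [NormedAddCommGroup F] [NormedSpace ℝ F] (L : (F × ℝ) ≃L[ℝ] E)
    {ℓ : E →L[ℝ] ℝ} (hℓ : ℓ ≠ 0) : ∃ B : E ≃L[ℝ] F × ℝ, ∀ y, (B y).2 = ℓ y := by
  have : FiniteDimensional ℝ (F × ℝ) := L.symm.toLinearEquiv.finiteDimensional
  have : FiniteDimensional ℝ F :=
    Module.Finite.of_surjective (LinearMap.fst ℝ F ℝ) LinearMap.fst_surjective
  have hE : Module.finrank ℝ E = Module.finrank ℝ F + 1 := by
    rw [← L.toLinearEquiv.finrank_eq, Module.finrank_prod, Module.finrank_self]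
  have hℓ' : ℓ.toLinearMap ≠ 0 := fun h ↦ hℓ (ContinuousLinearMap.coe_injective h)
  have hker : Module.finrank ℝ (LinearMap.ker ℓ.toLinearMap) = Module.finrank ℝ F := by
    have h1 := Module.Dual.finrank_ker_add_one_of_ne_zero (f := ℓ.toLinearMap) hℓ'
    omega
  -- `L` serves only to count dimensions. An isomorphism of the kernel with `F`, extended to `E` and
  -- paired with `ℓ`, is injective, hence bijective.
  let k : LinearMap.ker ℓ.toLinearMap ≃ₗ[ℝ] F := LinearEquiv.ofFinrankEq _ _ hker
  obtain ⟨k', hk'⟩ := k.toLinearMap.exists_extend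
  have hinj : Function.Injective (k'.prod ℓ.toLinearMap) := by
    rw [injective_iff_map_eq_zero]
    intro y hy
    obtain ⟨h1, h2⟩ := Prod.ext_iff.1 hy
    have hy' : y ∈ LinearMap.ker ℓ.toLinearMap := h2
    have h3 : k ⟨y, hy'⟩ = 0 := (LinearMap.congr_fun hk' ⟨y, hy'⟩).symm.trans h1
    exact congr_arg Subtype.val (k.map_eq_zero_iff.1 h3)
  refine ⟨(LinearEquiv.ofInjectiveOfFinrankEq _ hinj ?_).toContinuousLinearEquiv, fun y ↦ rfl⟩
  rw [Module.finrank_prod, Module.finrank_self, hE]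

/-- The local inverse is restricted to the open set where the derivative stays invertible, which
makes it smooth on its whole domain and so usable as a change of charts. -/
theorem ContDiffOn.exists_openPartialHomeomorph {E : Type*} [NormedAddCommGroup E]
    [NormedSpace ℝ E] [CompleteSpace E] {G : E → E} {U : Set E} (hU : IsOpen U)
    (hG : ContDiffOn ℝ ∞ G U) {a : E} (ha : a ∈ U) {A : E ≃L[ℝ] E}
    (hA : HasFDerivAt G (A : E →L[ℝ] E) a) :
    ∃ h : OpenPartialHomeomorph E E, a ∈ h.source ∧ h.source ⊆ U ∧ (∀ y, h y = G y) ∧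
      ContDiffOn ℝ ∞ h.symm h.target := by
  have hGa : ContDiffAt ℝ ∞ G a := hG.contDiffAt (hU.mem_nhds ha)
  have hcont : ContinuousOn (fderiv ℝ G) U := hG.continuousOn_fderiv_of_isOpen hU (by simp)
  let W : Set E := U ∩ fderiv ℝ G ⁻¹' range ((↑) : (E ≃L[ℝ] E) → E →L[ℝ] E)
  have hW : IsOpen W := hcont.isOpen_inter_preimage hU ContinuousLinearEquiv.isOpen
  let h := (hGa.toOpenPartialHomeomorph G hA (by simp)).restrOpen W hW
  refine ⟨h, ⟨hGa.mem_toOpenPartialHomeomorph_source hA (by simp), ha, A, hA.fderiv.symm⟩,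
    fun y hy ↦ hy.2.1, fun y ↦ rfl, fun z hz ↦ ?_⟩
  have hz' : h.symm z ∈ W := (h.map_target hz).2
  obtain ⟨hzU, A', hA'⟩ := hz'
  have hGz : ContDiffAt ℝ ∞ G (h.symm z) := hG.contDiffAt (hU.mem_nhds hzU)
  refine (h.contDiffAt_symm (f₀' := A') hz ?_ hGz).contDiffWithinAt
  rw [hA']
  exact (hGz.differentiableAt (by simp)).hasFDerivAt

section LevelSet

variable {E : Type*} [NormedAddCommGroup E] [NormedSpace ℝ E]
  {F : Type*} [NormedAddCommGroup F] [NormedSpace ℝ F]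
  {M : Type*} [TopologicalSpace M] {T : M → ℝ} {c : ℝ}

/-- The chart of the level set `T = c` obtained from a chart of the ambient manifold in which
`T - c` is the last coordinate. -/
noncomputable def sliceChart (L : (F × ℝ) ≃L[ℝ] E) (e : OpenPartialHomeomorph M E)
    (he : ∀ y ∈ e.source, (L.symm (e y)).2 = T y - c) (p : T ⁻¹' {c}) :
    OpenPartialHomeomorph (T ⁻¹' {c}) F :=
  have hinv : ∀ u : F, L (u, 0) ∈ e.target → e.symm (L (u, 0)) ∈ T ⁻¹' {c} := fun u hu ↦ by
    have h := he _ (e.map_target hu)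
    rw [e.right_inv hu, L.symm_apply_apply] at h
    exact (sub_eq_zero.1 h.symm)
  have happ : ∀ x : T ⁻¹' {c}, (x : M) ∈ e.source → L ((L.symm (e x)).1, 0) = e x := fun x hx ↦ by
    have h : (L.symm (e x)).2 = 0 := (he x hx).trans (sub_eq_zero.2 x.2)
    rw [← h, Prod.mk.eta, L.apply_symm_apply]
  open Classical in
  { toFun := fun x ↦ (L.symm (e x)).1
    -- Off the target, `p` is a default value.
    invFun := fun u ↦ if h : L (u, 0) ∈ e.target then ⟨e.symm (L (u, 0)), hinv u h⟩ else p
    source := Subtype.val ⁻¹' e.source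
    target := (fun u ↦ L (u, 0)) ⁻¹' e.target
    map_source' := fun x hx ↦ by
      change L ((L.symm (e x)).1, 0) ∈ e.target
      rw [happ x hx]
      exact e.map_source hx
    map_target' := fun u hu ↦ by
      have hu' : L (u, 0) ∈ e.target := hu
      rw [dif_pos hu']
      exact e.map_target hu'
    left_inv' := fun x hx ↦ by
      have h : L ((L.symm (e x)).1, 0) ∈ e.target := by
        rw [happ x hx]
        exact e.map_source hx
      rw [dif_pos h]
      refine Subtype.ext ?_
      change e.symm (L ((L.symm (e x)).1, 0)) = x
      rw [happ x hx, e.left_inv hx]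
    right_inv' := fun u hu ↦ by
      have hu' : L (u, 0) ∈ e.target := hu
      rw [dif_pos hu']
      change (L.symm (e (e.symm (L (u, 0))))).1 = u
      rw [e.right_inv hu', L.symm_apply_apply]
    open_source := e.open_source.preimage continuous_subtype_val
    open_target := e.open_target.preimage (by fun_prop)
    continuousOn_toFun := (continuous_fst.comp L.symm.continuous).comp_continuousOn
      (e.continuousOn.comp continuous_subtype_val.continuousOn fun x hx ↦ hx)
    continuousOn_invFun := by
      rw [Topology.IsInducing.subtypeVal.continuousOn_iff]
      refine (e.symm.continuousOn.comp (f := fun u ↦ L (u, 0)) (s := (fun u ↦ L (u, 0)) ⁻¹' e.target)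
        (by fun_prop) fun u hu ↦ hu).congr fun u hu ↦ ?_
      have hu' : L (u, 0) ∈ e.target := hu
      simp only [Function.comp_apply, dif_pos hu'] }

theorem sliceChart_target (L : (F × ℝ) ≃L[ℝ] E) (e : OpenPartialHomeomorph M E)
    (he : ∀ y ∈ e.source, (L.symm (e y)).2 = T y - c) (p : T ⁻¹' {c}) :
    (sliceChart L e he p).target = (fun u ↦ L (u, 0)) ⁻¹' e.target := rfl

theorem coe_sliceChart_symm (L : (F × ℝ) ≃L[ℝ] E) (e : OpenPartialHomeomorph M E)
    (he : ∀ y ∈ e.source, (L.symm (e y)).2 = T y - c) (p : T ⁻¹' {c}) {u : F}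
    (hu : L (u, 0) ∈ e.target) : ((sliceChart L e he p).symm u : M) = e.symm (L (u, 0)) :=
  congr_arg Subtype.val (dif_pos hu)

variable [FiniteDimensional ℝ E] [ChartedSpace E M] [IsManifold 𝓘(ℝ, E) ∞ M]

/-- Around a regular point, a smooth function minus a constant is the last coordinate of a chart. -/
theorem exists_chart_snd_eq (L : (F × ℝ) ≃L[ℝ] E) (hT : ContMDiff 𝓘(ℝ, E) 𝓘(ℝ, ℝ) ∞ T)
    (c : ℝ) {p : M} (hp : mfderiv 𝓘(ℝ, E) 𝓘(ℝ, ℝ) T p ≠ 0) :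
    ∃ e ∈ IsManifold.maximalAtlas 𝓘(ℝ, E) ∞ M, p ∈ e.source ∧
      ∀ y ∈ e.source, (L.symm (e y)).2 = T y - c := by
  have : CompleteSpace E := FiniteDimensional.complete ℝ E
  let φ := chartAt E p
  have hφ : φ ∈ IsManifold.maximalAtlas 𝓘(ℝ, E) ∞ M := IsManifold.chart_mem_maximalAtlas p
  have hps : p ∈ φ.source := mem_chart_source E p
  have hpt : φ p ∈ φ.target := φ.map_source hps
  let f : E → ℝ := fun u ↦ T (φ.symm u)
  have hf : ContDiffOn ℝ ∞ f φ.target :=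
    (hT.comp_contMDiffOn (contMDiffOn_symm_of_mem_maximalAtlas hφ)).contDiffOn
  have hfd : DifferentiableAt ℝ f (φ p) :=
    (hf.contDiffAt (φ.open_target.mem_nhds hpt)).differentiableAt (by simp)
  have hℓ : fderiv ℝ f (φ p) ≠ 0 := by
    intro h0
    apply hp
    rw [(hT.mdifferentiable (by simp) p).mfderiv]
    have h1 : writtenInExtChartAt 𝓘(ℝ, E) 𝓘(ℝ, ℝ) p T = f := by
      ext u
      rfl
    simp only [h1, modelWithCornersSelf_coe, range_id, fderivWithin_univ]
    exact h0
  obtain ⟨B, hB⟩ := exists_continuousLinearEquiv_snd_eq L hℓ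
  -- The last coordinate of the linear system `B` is the differential of `f` at `φ p`; replacing it
  -- by `f - c` leaves the derivative at that point equal to `L ∘ B`, which is invertible.
  let G : E → E := fun y ↦ L ((B y).1, f y - c)
  have hG : ContDiffOn ℝ ∞ G φ.target :=
    L.contDiff.comp_contDiffOn ((contDiff_fst.comp B.contDiff).contDiffOn.prodMk
      (hf.sub contDiffOn_const))
  have hA : HasFDerivAt G ((B.trans L : E ≃L[ℝ] E) : E →L[ℝ] E) (φ p) := by
    have h1 : HasFDerivAt (fun y ↦ ((B y).1, f y - c))
        (((ContinuousLinearMap.fst ℝ F ℝ).comp (B : E →L[ℝ] F × ℝ)).prod (fderiv ℝ f (φ p)))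
        (φ p) :=
      ((ContinuousLinearMap.fst ℝ F ℝ).comp (B : E →L[ℝ] F × ℝ)).hasFDerivAt.prodMk
        (hfd.hasFDerivAt.sub_const c)
    refine (L.hasFDerivAt.comp (φ p) h1).congr_fderiv ?_
    ext y
    exact congr_arg L (Prod.ext rfl (hB y).symm)
  obtain ⟨h, hah, hhU, hhG, hhs⟩ := hG.exists_openPartialHomeomorph φ.open_target hpt hA
  refine ⟨φ.trans h, OpenPartialHomeomorph.mem_maximalAtlas_of_contMDiffOn _ ?_ ?_, ?_, ?_⟩
  · have hh : ContMDiffOn 𝓘(ℝ, E) 𝓘(ℝ, E) ∞ h h.source :=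
      ((hG.mono hhU).congr fun y _ ↦ hhG y).contMDiffOn
    exact hh.comp ((contMDiffOn_of_mem_maximalAtlas hφ).mono fun y hy ↦ hy.1) fun y hy ↦ hy.2
  · exact (contMDiffOn_symm_of_mem_maximalAtlas hφ).comp
      (hhs.contMDiffOn.mono fun y hy ↦ hy.1) fun y hy ↦ hy.2
  · exact ⟨hps, hah⟩
  · intro y hy
    have h1 : (φ.trans h) y = L ((B (φ y)).1, f (φ y) - c) := hhG (φ y)
    rw [h1, L.symm_apply_apply]
    change T (φ.symm (φ y)) - c = T y - c
    rw [φ.left_inv hy.1]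


/-- A regular level set is a smoothly embedded hypersurface. -/
theorem exists_chartedSpace_levelSet (L : (F × ℝ) ≃L[ℝ] E) (hT : ContMDiff 𝓘(ℝ, E) 𝓘(ℝ, ℝ) ∞ T)
    (hreg : ∀ p, mfderiv 𝓘(ℝ, E) 𝓘(ℝ, ℝ) T p ≠ 0) (c : ℝ) :
    ∃ _ : ChartedSpace F (T ⁻¹' {c}), IsManifold 𝓘(ℝ, F) ∞ (T ⁻¹' {c}) ∧
      Manifold.IsSmoothEmbedding 𝓘(ℝ, F) 𝓘(ℝ, E) ∞ (Subtype.val : T ⁻¹' {c} → M) := by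
  choose e heA hpe he using fun p : T ⁻¹' {c} ↦ exists_chart_snd_eq L hT c (hreg p)
  let C : ChartedSpace F (T ⁻¹' {c}) :=
    { atlas := range fun p ↦ sliceChart L (e p) (he p) p
      chartAt := fun p ↦ sliceChart L (e p) (he p) p
      mem_chart_source := hpe
      chart_mem_atlas := mem_range_self }
  have hM : IsManifold 𝓘(ℝ, F) ∞ (T ⁻¹' {c}) := by
    refine isManifold_of_contDiffOn _ _ _ ?_
    rintro _ _ ⟨p, rfl⟩ ⟨q, rfl⟩
    have h1 : ContMDiffOn 𝓘(ℝ, E) 𝓘(ℝ, E) ∞ (e q ∘ (e p).symm)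
        ((e p).target ∩ (e p).symm ⁻¹' (e q).source) :=
      (contMDiffOn_of_mem_maximalAtlas (heA q)).comp
        ((contMDiffOn_symm_of_mem_maximalAtlas (heA p)).mono inter_subset_left)
        inter_subset_right
    have h2 : ContDiff ℝ ∞ (fun u : F ↦ L (u, 0)) :=
      L.contDiff.comp (contDiff_id.prodMk contDiff_const)
    have h3 : ContDiffOn ℝ ∞ (fun u : F ↦ (L.symm (e q ((e p).symm (L (u, 0))))).1)
        {u | L (u, 0) ∈ (e p).target ∧ (e p).symm (L (u, 0)) ∈ (e q).source} :=
      (contDiff_fst.comp L.symm.contDiff).comp_contDiffOn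
        (h1.contDiffOn.comp h2.contDiffOn fun u hu ↦ hu)
    refine h3.congr_mono (fun u hu ↦ ?_) fun u hu ↦ ?_
    · have hu' : L (u, 0) ∈ (e p).target := hu.1.1
      change (L.symm (e q ((sliceChart L (e p) (he p) p).symm u))).1 = _
      rw [coe_sliceChart_symm L (e p) (he p) p hu']
    · have hu' : L (u, 0) ∈ (e p).target := hu.1.1
      refine ⟨hu', ?_⟩
      have h4 : ((sliceChart L (e p) (he p) p).symm u : M) ∈ (e q).source := hu.1.2
      rwa [coe_sliceChart_symm L (e p) (he p) p hu'] at h4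
  refine ⟨C, hM, ⟨Manifold.IsImmersionOfComplement.isImmersion (F := ℝ) fun p ↦ ?_,
    Topology.IsEmbedding.subtypeVal⟩⟩
  -- In these two charts the inclusion is `u ↦ L (u, 0)`, the normal form of an immersion.
  refine Manifold.IsImmersionAtOfComplement.mk_of_charts L (sliceChart L (e p) (he p) p) (e p)
    (hpe p) (hpe p) (IsManifold.chart_mem_maximalAtlas p) (heA p) (fun x hx ↦ hx) fun u hu ↦ ?_
  have hu' : L (u, 0) ∈ (e p).target := by simpa [sliceChart_target] using hu
  change e p ((sliceChart L (e p) (he p) p).symm u) = L (u, 0)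
  rw [coe_sliceChart_symm L (e p) (he p) p hu', (e p).right_inv hu']

end LevelSet

/-- The derivative of an immersion is injective. -/
theorem Manifold.IsImmersionAt.injective_mfderiv {E E' : Type*}
    [NormedAddCommGroup E] [NormedSpace ℝ E] [NormedAddCommGroup E'] [NormedSpace ℝ E']
    {N M : Type*} [TopologicalSpace N] [ChartedSpace E N] [IsManifold 𝓘(ℝ, E) ∞ N]
    [TopologicalSpace M] [ChartedSpace E' M] [IsManifold 𝓘(ℝ, E') ∞ M] {f : N → M} {x : N}
    (hf : Manifold.IsImmersionAt 𝓘(ℝ, E) 𝓘(ℝ, E') ∞ f x) :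
    Function.Injective (mfderiv 𝓘(ℝ, E) 𝓘(ℝ, E') f x) := by
  have hfx : MDifferentiableAt 𝓘(ℝ, E) 𝓘(ℝ, E') f x := hf.contMDiffAt.mdifferentiableAt (by simp)
  let h := hf.isImmersionAtOfComplement_complement
  let φ := h.domChart
  let ψ := h.codChart
  have hxφ : x ∈ φ.source := h.mem_domChart_source
  have hxψ : f x ∈ ψ.source := h.mem_codChart_source
  have hφψ : ∀ y ∈ φ.source, φ y = (h.equiv.symm (ψ (f y))).1 := by
    intro y hy
    have h1 := h.writtenInCharts
      (show φ y ∈ (φ.extend 𝓘(ℝ, E)).target by simpa using φ.map_source hy)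
    have h2 : ψ (f (φ.symm (φ y))) = h.equiv (φ y, 0) := h1
    rw [φ.left_inv hy] at h2
    rw [h2, ContinuousLinearEquiv.symm_apply_apply]
  -- Dropping the complementary coordinate gives a smooth local left inverse of `f`.
  let r : M → N := fun y ↦ φ.symm (h.equiv.symm (ψ y)).1
  have hr : MDifferentiableAt 𝓘(ℝ, E') 𝓘(ℝ, E) r (f x) := by
    have h1 : ContMDiffAt 𝓘(ℝ, E') 𝓘(ℝ, E') ∞ ψ (f x) :=
      (contMDiffOn_of_mem_maximalAtlas h.codChart_mem_maximalAtlas).contMDiffAt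
        (ψ.open_source.mem_nhds hxψ)
    have h2 : ContMDiffAt 𝓘(ℝ, E') 𝓘(ℝ, E) ∞ (fun y ↦ (h.equiv.symm (ψ y)).1) (f x) :=
      (contDiff_fst.comp h.equiv.symm.contDiff).contMDiff.contMDiffAt.comp (f x) h1
    have h3 : ContMDiffAt 𝓘(ℝ, E) 𝓘(ℝ, E) ∞ φ.symm (h.equiv.symm (ψ (f x))).1 :=
      (contMDiffOn_symm_of_mem_maximalAtlas h.domChart_mem_maximalAtlas).contMDiffAt
        (φ.open_target.mem_nhds (by rw [← hφψ x hxφ]; exact φ.map_source hxφ))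
    exact (h3.comp (f x) h2).mdifferentiableAt (by simp)
  have hrf : r ∘ f =ᶠ[𝓝 x] id := by
    filter_upwards [φ.open_source.mem_nhds hxφ] with y hy
    change φ.symm (h.equiv.symm (ψ (f y))).1 = y
    rw [← hφψ y hy, φ.left_inv hy]
  have h4 : HasMFDerivAt 𝓘(ℝ, E) 𝓘(ℝ, E) (r ∘ f) x _ := hr.hasMFDerivAt.comp x hfx.hasMFDerivAt
  have h5 := hasMFDerivAt_unique h4 ((hasMFDerivAt_id x).congr_of_eventuallyEq hrf)
  exact Function.LeftInverse.injective fun v ↦ DFunLike.congr_fun h5 v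

/-- The bilinear form `A* B + b η²`. -/
noncomputable def pullbackAdd {E E' : Type*} [NormedAddCommGroup E] [NormedSpace ℝ E]
    [NormedAddCommGroup E'] [NormedSpace ℝ E'] (B : E' →L[ℝ] E' →L[ℝ] ℝ) (A : E →L[ℝ] E') (b : ℝ)
    (η : E →L[ℝ] ℝ) : E →L[ℝ] E →L[ℝ] ℝ :=
  (ContinuousLinearMap.precomp ℝ A).comp (B.comp A) + b • η.smulRight η

/-! ### Levels of a temporal function and the flow of its gradient. -/

namespace Spacetime

variable {m : ℕ} {M : Type*} [TopologicalSpace M]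
  [ChartedSpace (EuclideanSpace ℝ (Fin (m + 1))) M] [IsManifold (𝓡 (m + 1)) ∞ M]
  {g : Spacetime m M} {T : M → ℝ}

/-- A level of a temporal function is a spacelike hypersurface. -/
theorem isSpacelikeHypersurface_level (hT : ContMDiff (𝓡 (m + 1)) 𝓘(ℝ, ℝ) ∞ T)
    (hgrad : ∀ x, g.PastTimelike (g.grad T x)) {c : ℝ}
    [ChartedSpace (EuclideanSpace ℝ (Fin m)) (T ⁻¹' {c})] [IsManifold (𝓡 m) ∞ (T ⁻¹' {c})]
    (hemb : Manifold.IsSmoothEmbedding (𝓡 m) (𝓡 (m + 1)) ∞ (Subtype.val : T ⁻¹' {c} → M)) :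
    g.IsSpacelikeHypersurface (T ⁻¹' {c}) := by
  refine ⟨inferInstance, hemb, fun x v hv ↦ ?_⟩
  have hinj := (hemb.isImmersion.isImmersionAt x).injective_mfderiv
  refine lorentz_pos_of_orthogonal (g.symm x) (g.signature x) (hgrad x).1 ?_ fun h0 ↦
    hv (hinj (h0.trans (map_zero _).symm))
  rw [metric_grad]
  have hconst : T ∘ (Subtype.val : T ⁻¹' {c} → M) = fun _ ↦ c := funext fun y ↦ y.2
  have h1 := mfderiv_comp x (hT.mdifferentiable (by simp) (x : M))
    (hemb.contMDiff.mdifferentiable (by simp) x)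
  rw [hconst, mfderiv_const] at h1
  exact (DFunLike.congr_fun h1 v).symm

theorem exists_chartedSpace_level (hT : ContMDiff (𝓡 (m + 1)) 𝓘(ℝ, ℝ) ∞ T)
    (hgrad : ∀ x, g.PastTimelike (g.grad T x)) (c : ℝ) :
    ∃ _ : ChartedSpace (EuclideanSpace ℝ (Fin m)) (T ⁻¹' {c}), IsManifold (𝓡 m) ∞ (T ⁻¹' {c}) ∧
      Manifold.IsSmoothEmbedding (𝓡 m) (𝓡 (m + 1)) ∞ (Subtype.val : T ⁻¹' {c} → M) := by
  refine exists_chartedSpace_levelSet (ContinuousLinearEquiv.ofFinrankEq ?_) hT (fun p h0 ↦ ?_) c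
  · rw [Module.finrank_prod, Module.finrank_self, finrank_euclideanSpace_fin,
      finrank_euclideanSpace_fin]
  · have h := (hgrad p).1
    rw [metric_grad, h0] at h
    exact lt_irrefl _ h

/-- The vector field proportional to the gradient of `T` along which `T` has unit speed. -/
noncomputable def unitGrad (g : Spacetime m M) (T : M → ℝ) (x : M) : TangentSpace (𝓡 (m + 1)) x :=
  (g.metric x (g.grad T x) (g.grad T x))⁻¹ • g.grad T x

theorem contMDiff_metric_grad (hT : ContMDiff (𝓡 (m + 1)) 𝓘(ℝ, ℝ) ∞ T) :
    ContMDiff (𝓡 (m + 1)) 𝓘(ℝ, ℝ) ∞ (fun x ↦ g.metric x (g.grad T x) (g.grad T x)) := fun x ↦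
  g.contMDiff_metric.contMDiffAt.bilin_apply (b := id) contMDiffAt_id
    (g.contMDiff_grad hT x) (g.contMDiff_grad hT x)

theorem contMDiff_inv_metric_grad (hT : ContMDiff (𝓡 (m + 1)) 𝓘(ℝ, ℝ) ∞ T)
    (hgrad : ∀ x, g.PastTimelike (g.grad T x)) :
    ContMDiff (𝓡 (m + 1)) 𝓘(ℝ, ℝ) ∞ (fun x ↦ (g.metric x (g.grad T x) (g.grad T x))⁻¹) :=
  (contMDiff_metric_grad hT).inv₀ fun x ↦ (hgrad x).1.ne

theorem contMDiff_unitGrad (hT : ContMDiff (𝓡 (m + 1)) 𝓘(ℝ, ℝ) ∞ T)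
    (hgrad : ∀ x, g.PastTimelike (g.grad T x)) :
    ContMDiff (𝓡 (m + 1)) (𝓡 (m + 1)).tangent ∞
      (fun x ↦ (⟨x, g.unitGrad T x⟩ : TangentBundle (𝓡 (m + 1)) M)) :=
  (contMDiff_inv_metric_grad hT hgrad).smul_section (g.contMDiff_grad hT)

theorem futureTimelike_unitGrad (hgrad : ∀ x, g.PastTimelike (g.grad T x)) (x : M) :
    g.FutureTimelike (g.unitGrad T x) := by
  obtain ⟨h1, h2⟩ := hgrad x
  have h3 := inv_lt_zero.2 h1
  unfold FutureTimelike unitGrad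
  simp only [map_smul, smul_apply, smul_eq_mul]
  exact ⟨by rw [inv_mul_cancel₀ h1.ne, mul_one]; exact h3, mul_neg_of_neg_of_pos h3 h2⟩

theorem mfderiv_unitGrad (hgrad : ∀ x, g.PastTimelike (g.grad T x)) (x : M) :
    mfderiv (𝓡 (m + 1)) 𝓘(ℝ, ℝ) T x (g.unitGrad T x) = (1 : ℝ) := by
  rw [← metric_grad, unitGrad, map_smul, smul_eq_mul, inv_mul_cancel₀ (hgrad x).1.ne]

theorem metric_unitGrad (x : M) (w : TangentSpace (𝓡 (m + 1)) x) :
    g.metric x (g.unitGrad T x) w =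
      (g.metric x (g.grad T x) (g.grad T x))⁻¹ * g.metric x (g.grad T x) w := by
  rw [unitGrad, map_smul, smul_apply, smul_eq_mul]

/-- Along the integral curves of `unitGrad g T`, the function `T` is the parameter. -/
theorem eq_add_of_hasMFDerivAt_unitGrad (hT : ContMDiff (𝓡 (m + 1)) 𝓘(ℝ, ℝ) ∞ T)
    (hgrad : ∀ x, g.PastTimelike (g.grad T x)) {I : Set ℝ} (hIo : IsOpen I) (hIc : I.OrdConnected)
    (h0 : (0 : ℝ) ∈ I) {γ : ℝ → M}
    (hγ : ∀ s ∈ I, HasMFDerivAt 𝓘(ℝ, ℝ) (𝓡 (m + 1)) γ s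
      ((1 : ℝ →L[ℝ] ℝ).smulRight (g.unitGrad T (γ s)))) {s : ℝ} (hs : s ∈ I) :
    T (γ s) = s + T (γ 0) := by
  have hd : ∀ r ∈ I, HasDerivAt (fun s ↦ T (γ s)) 1 r := by
    intro r hr
    have h1 := (hT.mdifferentiable (by simp) (γ r)).hasMFDerivAt.comp r (hγ r hr)
    have h2 : HasFDerivAt (𝕜 := ℝ) (E := ℝ) (F := ℝ) (fun s ↦ T (γ s)) _ r :=
      hasMFDerivAt_iff_hasFDerivAt.1 h1
    have h3 := h2.hasDerivAt
    convert h3 using 1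
    have h4 : ((1 : ℝ →L[ℝ] ℝ).smulRight (g.unitGrad T (γ r))) (1 : ℝ) = g.unitGrad T (γ r) :=
      one_smul ℝ (g.unitGrad T (γ r))
    exact (mfderiv_unitGrad hgrad (γ r)).symm.trans (congr_arg (mfderiv _ _ T (γ r)) h4.symm)
  have hd' : ∀ r ∈ I, HasDerivAt (fun s ↦ T (γ s) - s) 0 r := fun r hr ↦
    ((hd r hr).sub (hasDerivAt_id r)).congr_deriv (sub_self 1)
  have h := hIo.is_const_of_deriv_eq_zero hIc.isPreconnected
    (fun r hr ↦ (hd' r hr).differentiableAt.differentiableWithinAt)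
    (fun r hr ↦ (hd' r hr).deriv) hs h0
  linarith

/-- Completeness: on the maximal integral curve `T` is the parameter plus a constant and takes every
real value, since the curve is an inextendible timelike one; hence its interval is all of `ℝ`. -/
theorem exists_integralCurve_unitGrad [T2Space M] (hT : ContMDiff (𝓡 (m + 1)) 𝓘(ℝ, ℝ) ∞ T)
    (hgrad : ∀ x, g.PastTimelike (g.grad T x))
    (hsurj : ∀ I γ, g.IsInextendibleTimelikeCurve I γ → ∀ c, ∃ s ∈ I, T (γ s) = c) (p : M) :
    ∃ γ : ℝ → M, γ 0 = p ∧ IsMIntegralCurve (I := 𝓡 (m + 1)) γ (g.unitGrad T) := by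
  obtain ⟨I, γ, hI, h0, hγ0, hd, -⟩ := exists_isInextendibleTimelikeCurve
    (futureTimelike_unitGrad hgrad) (contMDiff_unitGrad hT hgrad) p
  refine ⟨γ, hγ0, fun s ↦ hd s ?_⟩
  obtain ⟨r, hr, hrs⟩ := hsurj I γ hI (s + T (γ 0))
  rw [eq_add_of_hasMFDerivAt_unitGrad hT hgrad hI.isOpen hI.ordConnected h0 hd hr] at hrs
  rwa [← add_right_cancel hrs]

/-- The splitting of the manifold by the flow of the unit speed gradient. -/
theorem exists_diffeomorph_flow [T2Space M] (hT : ContMDiff (𝓡 (m + 1)) 𝓘(ℝ, ℝ) ∞ T)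
    (hgrad : ∀ x, g.PastTimelike (g.grad T x))
    (hsurj : ∀ I γ, g.IsInextendibleTimelikeCurve I γ → ∀ c, ∃ s ∈ I, T (γ s) = c)
    [ChartedSpace (EuclideanSpace ℝ (Fin m)) (T ⁻¹' {0})] [IsManifold (𝓡 m) ∞ (T ⁻¹' {0})]
    (hemb : Manifold.IsSmoothEmbedding (𝓡 m) (𝓡 (m + 1)) ∞ (Subtype.val : T ⁻¹' {0} → M)) :
    ∃ Ψ : (ℝ × (T ⁻¹' {0} : Set M)) ≃ₘ^∞⟮𝓘(ℝ, ℝ).prod (𝓡 m), 𝓡 (m + 1)⟯ M,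
      (∀ w, T (Ψ w) = w.1) ∧ (∀ x : T ⁻¹' {0}, Ψ (0, x) = x) ∧
      ∀ x, IsMIntegralCurve (I := 𝓡 (m + 1)) (fun s ↦ Ψ (s, x)) (g.unitGrad T) := by
  obtain ⟨Φ, hΦ, hΦ0, hΦd, hΦa⟩ := exists_contMDiff_flow (contMDiff_unitGrad hT hgrad)
    (exists_integralCurve_unitGrad hT hgrad hsurj)
  have hTΦ : ∀ s p, T (Φ (s, p)) = s + T p := fun s p ↦ by
    have h := eq_add_of_hasMFDerivAt_unitGrad hT hgrad isOpen_univ ordConnected_univ (mem_univ 0)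
      (fun s _ ↦ hΦd p s) (mem_univ s)
    rwa [hΦ0] at h
  have hproj : ContMDiff (𝓡 (m + 1)) (𝓡 (m + 1)) ∞ fun y ↦ Φ (-T y, y) :=
    hΦ.comp (hT.neg.prodMk contMDiff_id)
  have hmem : ∀ y, Φ (-T y, y) ∈ T ⁻¹' {0} := fun y ↦ by
    change T (Φ (-T y, y)) = 0
    rw [hTΦ, neg_add_cancel]
  let Ψ : (ℝ × (T ⁻¹' {0} : Set M)) ≃ₘ^∞⟮𝓘(ℝ, ℝ).prod (𝓡 m), 𝓡 (m + 1)⟯ M :=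
    { toFun := fun w ↦ Φ (w.1, w.2)
      -- Flowing `y` for time `-T y` lands on the zero level, because the flow moves `T` at unit
      -- speed.
      invFun := fun y ↦ (T y, ⟨Φ (-T y, y), hmem y⟩)
      left_inv := fun w ↦ by
        have h1 : T w.2 = 0 := w.2.2
        have h2 : T (Φ (w.1, w.2)) = w.1 := by rw [hTΦ, h1, add_zero]
        refine Prod.ext h2 (Subtype.ext ?_)
        change Φ (-T (Φ (w.1, w.2)), Φ (w.1, w.2)) = w.2
        rw [h2, ← hΦa, neg_add_cancel, hΦ0]
      right_inv := fun y ↦ by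
        change Φ (T y, Φ (-T y, y)) = y
        rw [← hΦa, add_neg_cancel, hΦ0]
      contMDiff_toFun := hΦ.comp (contMDiff_fst.prodMk (hemb.contMDiff.comp contMDiff_snd))
      -- A continuous map into the level is smooth as soon as it is smooth into `M`, the inclusion
      -- being an immersion.
      contMDiff_invFun := hT.prodMk ((ContMDiff.iff_comp_isImmersion hemb.isImmersion).2
        ⟨hproj.continuous.subtype_mk hmem, hproj⟩) }
  refine ⟨Ψ, fun w ↦ ?_, fun x ↦ hΦ0 x, fun x ↦ hΦd x⟩
  change T (Φ (w.1, w.2)) = w.1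
  have h1 : T w.2 = 0 := w.2.2
  rw [hTΦ, h1, add_zero]

end Spacetime

/-! ### The orthogonal splitting of the metric. -/

namespace Spacetime

section Splitting

variable {m : ℕ} {M : Type*} [TopologicalSpace M]
  [ChartedSpace (EuclideanSpace ℝ (Fin (m + 1))) M] [IsManifold (𝓡 (m + 1)) ∞ M]
  {g : Spacetime m M} {T : M → ℝ}
  [ChartedSpace (EuclideanSpace ℝ (Fin m)) (T ⁻¹' {0})] [IsManifold (𝓡 m) ∞ (T ⁻¹' {0})]
  {Ψ : (ℝ × (T ⁻¹' {0} : Set M)) ≃ₘ^∞⟮𝓘(ℝ, ℝ).prod (𝓡 m), 𝓡 (m + 1)⟯ M}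

omit [ChartedSpace (EuclideanSpace ℝ (Fin (m + 1))) M] [IsManifold (𝓡 (m + 1)) ∞ M]
  [IsManifold (𝓡 m) ∞ (T ⁻¹' {0})] in
theorem timeForm_apply (w : ℝ × (T ⁻¹' {0} : Set M))
    (v : TangentSpace (𝓘(ℝ, ℝ).prod (𝓡 m)) w) : timeForm w v = v.1 :=
  DFunLike.congr_fun (mfderiv_fst (I := 𝓘(ℝ, ℝ)) (I' := 𝓡 m) (x := w)) v

/-- The coordinate vector `∂_𝒯`. -/
def timeDirection (w : ℝ × (T ⁻¹' {0} : Set M)) : TangentSpace (𝓘(ℝ, ℝ).prod (𝓡 m)) w :=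
  ((1 : ℝ), (0 : EuclideanSpace ℝ (Fin m)))

/-- The lapse function of the splitting. -/
noncomputable def lapse (g : Spacetime m M) (T : M → ℝ) (x : M) : ℝ :=
  -(g.metric x (g.grad T x) (g.grad T x))⁻¹

/-- The spatial part of the metric in the splitting. -/
noncomputable def spatialMetric (g : Spacetime m M)
    (Ψ : (ℝ × (T ⁻¹' {0} : Set M)) ≃ₘ^∞⟮𝓘(ℝ, ℝ).prod (𝓡 m), 𝓡 (m + 1)⟯ M)
    (w : ℝ × (T ⁻¹' {0} : Set M)) :
    TangentSpace (𝓘(ℝ, ℝ).prod (𝓡 m)) w →L[ℝ] TangentSpace (𝓘(ℝ, ℝ).prod (𝓡 m)) w →L[ℝ] ℝ :=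
  pullbackAdd (E := ℝ × EuclideanSpace ℝ (Fin m)) (E' := EuclideanSpace ℝ (Fin (m + 1)))
    (g.metric (Ψ w)) (mfderiv (𝓘(ℝ, ℝ).prod (𝓡 m)) (𝓡 (m + 1)) Ψ w) (g.lapse T (Ψ w)) (timeForm w)

omit [IsManifold (𝓡 m) ∞ (T ⁻¹' {0})] in
theorem spatialMetric_apply (w : ℝ × (T ⁻¹' {0} : Set M))
    (u v : TangentSpace (𝓘(ℝ, ℝ).prod (𝓡 m)) w) :
    g.spatialMetric Ψ w u v =
      g.metric (Ψ w) (mfderiv (𝓘(ℝ, ℝ).prod (𝓡 m)) (𝓡 (m + 1)) Ψ w u)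
        (mfderiv (𝓘(ℝ, ℝ).prod (𝓡 m)) (𝓡 (m + 1)) Ψ w v) +
      g.lapse T (Ψ w) * (timeForm w u * timeForm w v) := rfl

theorem contMDiff_spatialMetric (hT : ContMDiff (𝓡 (m + 1)) 𝓘(ℝ, ℝ) ∞ T)
    (hgrad : ∀ x, g.PastTimelike (g.grad T x)) :
    ContMDiff (𝓘(ℝ, ℝ).prod (𝓡 m))
      ((𝓘(ℝ, ℝ).prod (𝓡 m)).prod 𝓘(ℝ, (ℝ × EuclideanSpace ℝ (Fin m)) →L[ℝ]
        (ℝ × EuclideanSpace ℝ (Fin m)) →L[ℝ] ℝ)) ∞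
      (fun w ↦ TotalSpace.mk' ((ℝ × EuclideanSpace ℝ (Fin m)) →L[ℝ]
        (ℝ × EuclideanSpace ℝ (Fin m)) →L[ℝ] ℝ) w (g.spatialMetric Ψ w)) := by
  intro w₀
  refine contMDiffAt_bilin_of_constField fun u v ↦ ?_
  have hΨ : ∀ u : ℝ × EuclideanSpace ℝ (Fin m), ContMDiffAt (𝓘(ℝ, ℝ).prod (𝓡 m))
      (𝓡 (m + 1)).tangent ∞ (fun w ↦ (⟨Ψ w, mfderiv (𝓘(ℝ, ℝ).prod (𝓡 m)) (𝓡 (m + 1)) Ψ w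
        (constField (𝓘(ℝ, ℝ).prod (𝓡 m)) w₀ u w)⟩ : TangentBundle (𝓡 (m + 1)) M)) w₀ := fun u ↦
    (Ψ.contMDiff.contMDiff_tangentMap (m := ∞) (by simp)).contMDiffAt.comp w₀
      (contMDiffAt_constField (I := 𝓘(ℝ, ℝ).prod (𝓡 m)) w₀ u)
  have htime : ∀ u : ℝ × EuclideanSpace ℝ (Fin m), ContMDiffAt (𝓘(ℝ, ℝ).prod (𝓡 m)) 𝓘(ℝ, ℝ) ∞
      (fun w ↦ (timeForm w (constField (𝓘(ℝ, ℝ).prod (𝓡 m)) w₀ u w) : ℝ)) w₀ := fun u ↦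
    contMDiff_fst.contMDiffAt_mfderiv_apply
      (contMDiffAt_constField (I := 𝓘(ℝ, ℝ).prod (𝓡 m)) w₀ u)
  have hlapse : ContMDiffAt (𝓘(ℝ, ℝ).prod (𝓡 m)) 𝓘(ℝ, ℝ) ∞ (fun w ↦ g.lapse T (Ψ w)) w₀ :=
    ((contMDiff_inv_metric_grad hT hgrad).neg.comp Ψ.contMDiff).contMDiffAt
  have hmetric := g.contMDiff_metric.contMDiffAt.bilin_apply Ψ.contMDiff.contMDiffAt (hΨ u) (hΨ v)
  exact hmetric.add (hlapse.mul ((htime u).mul (htime v)))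

/-- The flow of the unit speed gradient of a temporal function gives an orthogonal splitting. -/
theorem isOrthogonalSplitting (hT : ContMDiff (𝓡 (m + 1)) 𝓘(ℝ, ℝ) ∞ T)
    (hgrad : ∀ x, g.PastTimelike (g.grad T x)) (htime : ∀ w, T (Ψ w) = w.1)
    (hinit : ∀ x : T ⁻¹' {0}, Ψ (0, x) = x)
    (hflow : ∀ x, IsMIntegralCurve (I := 𝓡 (m + 1)) (fun s ↦ Ψ (s, x)) (g.unitGrad T)) :
    g.IsOrthogonalSplitting T (T ⁻¹' {0}) Ψ (fun w ↦ g.lapse T (Ψ w)) (g.spatialMetric Ψ) := by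
  have hinj : ∀ w, Function.Injective (mfderiv (𝓘(ℝ, ℝ).prod (𝓡 m)) (𝓡 (m + 1)) Ψ w) := fun w ↦
    (Ψ.mfderivToContinuousLinearEquiv (by simp) w).injective
  have hdT : ∀ (w) (v : TangentSpace (𝓘(ℝ, ℝ).prod (𝓡 m)) w),
      g.metric (Ψ w) (g.grad T (Ψ w)) (mfderiv (𝓘(ℝ, ℝ).prod (𝓡 m)) (𝓡 (m + 1)) Ψ w v) =
        timeForm w v := by
    intro w v
    have h1 := mfderiv_comp w (hT.mdifferentiable (by simp) (Ψ w))
      (Ψ.contMDiff.mdifferentiable (by simp) w)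
    rw [show T ∘ Ψ = Prod.fst from funext htime] at h1
    rw [metric_grad]
    exact (DFunLike.congr_fun h1 v).symm
  have hcoord : ∀ w : ℝ × (T ⁻¹' {0} : Set M),
      mfderiv (𝓘(ℝ, ℝ).prod (𝓡 m)) (𝓡 (m + 1)) Ψ w (timeDirection w) = g.unitGrad T (Ψ w) := by
    intro w
    have h1 := mfderiv_comp (I := 𝓘(ℝ, ℝ)) w.1 (g := Ψ) (f := fun s : ℝ ↦ (s, w.2))
      (Ψ.contMDiff.mdifferentiable (by simp) (w.1, w.2))
      (mdifferentiableAt_id.prodMk mdifferentiableAt_const)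
    have h2 := (hflow w.2 w.1).mfderiv
    have h3 := DFunLike.congr_fun (h1.symm.trans h2) (1 : ℝ)
    have h4 : ((1 : ℝ →L[ℝ] ℝ).smulRight (g.unitGrad T (Ψ w))) (1 : ℝ) = g.unitGrad T (Ψ w) :=
      one_smul ℝ (g.unitGrad T (Ψ w))
    refine Eq.trans ?_ (h3.trans h4)
    have h5 := mfderiv_prod_left (I := 𝓘(ℝ, ℝ)) (I' := 𝓡 m) (x₀ := w.1) (y₀ := w.2)
    exact (congr_arg (mfderiv (𝓘(ℝ, ℝ).prod (𝓡 m)) (𝓡 (m + 1)) Ψ w)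
      (DFunLike.congr_fun h5 (1 : ℝ))).symm
  have htd : ∀ w : ℝ × (T ⁻¹' {0} : Set M), timeForm (m := m) w (timeDirection w) = 1 := fun w ↦
    timeForm_apply w _
  -- The image of `∂_𝒯` is `unitGrad`, whose product with the image of `v` is `-β d𝒯(v)`; the added
  -- term `β d𝒯²` cancels it.
  have hrad : ∀ (w) (v : TangentSpace (𝓘(ℝ, ℝ).prod (𝓡 m)) w), g.spatialMetric Ψ w
      (timeDirection w) v = 0 := by
    intro w v
    rw [spatialMetric_apply, hcoord, metric_unitGrad, hdT, htd, lapse]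
    ring
  have hpos : ∀ (w) (v : TangentSpace (𝓘(ℝ, ℝ).prod (𝓡 m)) w),
      timeForm w v = 0 → v ≠ 0 → 0 < g.spatialMetric Ψ w v v := by
    intro w v hv hv0
    rw [spatialMetric_apply, hv, mul_zero, mul_zero, add_zero]
    exact lorentz_pos_of_orthogonal (g.symm _) (g.signature _) (hgrad _).1 ((hdT w v).trans hv)
      fun h0 ↦ hv0 (hinj w (h0.trans (map_zero _).symm))
  have hsymm : ∀ w u v, g.spatialMetric Ψ w u v = g.spatialMetric Ψ w v u := by
    intro w u v
    rw [spatialMetric_apply, spatialMetric_apply, g.symm]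
    ring
  have hcoordRad : ∀ (w : ℝ × (T ⁻¹' {0} : Set M)) (u : TangentSpace (𝓘(ℝ, ℝ).prod (𝓡 m)) w),
      (∀ v, g.spatialMetric Ψ w u v = 0) ↔
        ∃ r : ℝ, u = r • timeDirection w := by
    intro w u
    constructor
    · intro hu
      -- Removing the time component of a radical vector leaves a vector tangent to the slice and
      -- still in the radical, which positivity on the slice forces to vanish.
      refine ⟨timeForm w u, sub_eq_zero.1 ?_⟩
      by_contra hne
      have h1 := hpos w _ ?_ hne
      · have hz : ∀ v, g.spatialMetric Ψ w (u - timeForm w u • timeDirection w) v = 0 :=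
          fun v ↦ by
            rw [map_sub, sub_apply, hu, map_smul, smul_apply, hrad, smul_zero, sub_zero]
        rw [hz] at h1
        exact lt_irrefl _ h1
      · rw [map_sub, map_smul, htd, smul_eq_mul, mul_one, sub_self]
    · rintro ⟨r, rfl⟩ v
      rw [map_smul, smul_apply, hrad, smul_zero]
  refine ⟨htime, hinit, fun w ↦ ?_, ?_, contMDiff_spatialMetric hT hgrad, hsymm, fun w u v ↦ ?_,
    hpos, hcoordRad, fun w u ↦ ?_⟩
  · exact neg_pos.2 (inv_lt_zero.2 (hgrad _).1)
  · exact (contMDiff_inv_metric_grad hT hgrad).neg.comp Ψ.contMDiff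
  · rw [spatialMetric_apply]
    ring
  · refine (hcoordRad w u).trans ?_
    have hne : g.metric (Ψ w) (g.grad T (Ψ w)) (g.grad T (Ψ w)) ≠ 0 := (hgrad _).1.ne
    constructor
    · rintro ⟨r, rfl⟩
      refine ⟨r * (g.metric (Ψ w) (g.grad T (Ψ w)) (g.grad T (Ψ w)))⁻¹, ?_⟩
      rw [map_smul, hcoord, unitGrad, smul_smul]
    · rintro ⟨r, hr⟩
      refine ⟨r * g.metric (Ψ w) (g.grad T (Ψ w)) (g.grad T (Ψ w)), hinj w ?_⟩
      rw [hr, map_smul, hcoord, unitGrad, smul_smul, mul_assoc, mul_inv_cancel₀ hne, mul_one]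

end Splitting

end Spacetime

theorem proposition2p2 {m : ℕ} {M : Type*} [TopologicalSpace M] [T2Space M]
    [SecondCountableTopology M] [ConnectedSpace M]
    [ChartedSpace (EuclideanSpace ℝ (Fin (m + 1))) M] [IsManifold (𝓡 (m + 1)) ∞ M]
    (g : Spacetime m M) (hg : g.GloballyHyperbolic)
    (t : M → ℝ) (ht : g.IsCauchyTimeFunction t)
    (hstep : ∀ c : ℝ, ∃ (a b : ℝ) (τ : M → ℝ),
      g.IsTemporalStepFunction t c (c - 2) a b (c + 2) τ) :
    ∃ T : M → ℝ, ContMDiff (𝓡 (m + 1)) 𝓘(ℝ, ℝ) ∞ T ∧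
      (∀ x, g.PastTimelike (g.grad T x)) ∧
      -- `σ` is the parameterization by `t` of an inextendible timelike curve `γ`
      (∀ (I : Set ℝ) (γ : ℝ → M), g.IsInextendibleTimelikeCurve I γ →
        ∀ σ : ℝ → M, (∀ s ∈ I, σ (t (γ s)) = γ s) →
          Tendsto (fun s ↦ T (σ s)) atTop atTop ∧ Tendsto (fun s ↦ T (σ s)) atBot atBot) ∧
      (∀ c : ℝ, g.IsCauchy (T ⁻¹' {c}) ∧
        ∃ _ : ChartedSpace (EuclideanSpace ℝ (Fin m)) (T ⁻¹' {c}),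
          g.IsSpacelikeHypersurface (T ⁻¹' {c})) ∧
      ∃ (_ : ChartedSpace (EuclideanSpace ℝ (Fin m)) (T ⁻¹' {0}))
        (_ : IsManifold (𝓡 m) ∞ (T ⁻¹' {0})),
        g.IsSpacelikeHypersurface (T ⁻¹' {0}) ∧
        ∃ (Ψ : (ℝ × (T ⁻¹' {0} : Set M)) ≃ₘ^∞⟮𝓘(ℝ, ℝ).prod (𝓡 m), 𝓡 (m + 1)⟯ M)
          (β : ℝ × (T ⁻¹' {0} : Set M) → ℝ)
          (h : ∀ w : ℝ × (T ⁻¹' {0} : Set M),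
            TangentSpace (𝓘(ℝ, ℝ).prod (𝓡 m)) w →L[ℝ]
              TangentSpace (𝓘(ℝ, ℝ).prod (𝓡 m)) w →L[ℝ] ℝ),
          g.IsOrthogonalSplitting T (T ⁻¹' {0}) Ψ β h := by
  obtain ⟨T, hT, hgrad, hTt⟩ := Spacetime.exists_temporalFunction ht hstep
  have hsurj : ∀ I γ, g.IsInextendibleTimelikeCurve I γ → ∀ c, ∃ s ∈ I, T (γ s) = c :=
    fun I γ h c ↦ ht.exists_temporalFunction_eq hT.continuous hTt h c
  refine ⟨T, hT, hgrad, fun I γ h σ hσ ↦ ht.tendsto_temporalFunction hTt h hσ, fun c ↦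
    ⟨Spacetime.isCauchy_of_pastTimelike_grad hT hgrad hsurj c, ?_⟩, ?_⟩
  · obtain ⟨C, hC, hemb⟩ := Spacetime.exists_chartedSpace_level hT hgrad c
    exact ⟨C, Spacetime.isSpacelikeHypersurface_level hT hgrad hemb⟩
  · obtain ⟨C, hC, hemb⟩ := Spacetime.exists_chartedSpace_level hT hgrad 0
    obtain ⟨Ψ, htime, hinit, hflow⟩ := Spacetime.exists_diffeomorph_flow hT hgrad hsurj hemb
    exact ⟨C, hC, Spacetime.isSpacelikeHypersurface_level hT hgrad hemb, Ψ, _, _,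
      Spacetime.isOrthogonalSplitting hT hgrad htime hinit hflow⟩
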